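/- **Proposition 2.1 (concentration).** There is an absolute constant $C>0$ such that the following holds. For a real random variable $a$ put $\kappa:=\sup_{p\ge 1}p^{-1/2}(\mathbb E|a|^p)^{1/p}$ (the supremum is over real $p\ge1$), and for a nonempty bounded set $K\subset\mathbb R^n$ put $w(K):=\mathbb E\sup_{z\in K-K}\langle g,z\rangle$, where $g$ is a standard Gaussian vector in $\mathbb R^n$ and $K-K=\{u-v:u,v\in K\}$. Let $a$ be symmetric with unit variance and sub-gaussian, i.e. $\kappa<\infty$. Let $m\ge1$, and let $a_1,\dots,a_m$ be independent random vectors in $\mathbb R^n$ whose coordinates are i.i.d. copies of $a$. Let $K$ be a subset of the closed Euclidean unit ball of $\mathbb R^n$, let $x\in K$ with $\|x\|_2=1$, and let $\theta:\mathbb R\to[-1,1]$ be any measurable function. Let $y_1,\dots,y_m$ be random variables with values in $\{-1,1\}$ which, conditionally on $(a_1,\dots,a_m)$, are independent and have means $\mathbb E(y_i\mid a_1,\dots,a_m)=\theta(\langle a_i,x\rangle)$ almost surely, $i=1,\dots,m$. Set $$f_x(z):=\frac1m\sum_{i=1}^m y_i\langle a_i,z\rangle,\qquad z\in\mathbb R^n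 .$$ Then for every $\beta>0$, $$\mathbb P\left(\sup_{z\in K-K}\bigl|f_x(z)-\mathbb E f_x(z)\bigr|\ \ge\ C\,\kappa\,\frac{w(K)+\beta}{\sqrt m}\right)\le 4e^{-\beta^2}.$$ -/

import Mathlib

open MeasureTheory ProbabilityTheory
open scoped Pointwise ENNReal

namespace OneBitCS

/-- The sub-gaussian norm `κ = sup_{p ≥ 1} p^{-1/2} (E |X|^p)^{1/p}` of a real random variable,
as an extended nonnegative number; `X` is sub-gaussian iff it is finite. -/
noncomputable def subgaussianNorm {Ω : Type*} [MeasurableSpace Ω] (X : Ω → ℝ) (μ : Measure Ω) :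
    ℝ≥0∞ :=
  ⨆ (p : ℝ) (_ : 1 ≤ p),
    ENNReal.ofReal (p ^ (-(1 / 2) : ℝ)) * (∫⁻ ω, ENNReal.ofReal (|X ω| ^ p) ∂μ) ^ (1 / p)

/-- The Gaussian mean width `w(K) = E sup_{z ∈ K - K} ⟨g, z⟩`, `g` a standard Gaussian vector. -/
noncomputable def meanWidth {n : ℕ} (K : Set (EuclideanSpace ℝ (Fin n))) : ℝ :=
  ∫ g, (⨆ z : ↥(K - K), inner ℝ g (z : EuclideanSpace ℝ (Fin n)))
    ∂(stdGaussian (EuclideanSpace ℝ (Fin n)))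

/-- `X` is a symmetric, sub-gaussian random variable of unit variance. -/
structure IsSymmSubgaussianUnit {Ω : Type*} [MeasurableSpace Ω] (X : Ω → ℝ) (μ : Measure Ω) :
    Prop where
  measurable : Measurable X
  symmetric : IdentDistrib X (fun ω => -X ω) μ μ
  subgaussian : subgaussianNorm X μ < ∞
  unit_variance : variance X μ = 1

/-- `a 0, …, a (m-1)` are independent random vectors in `ℝⁿ`, and the coordinates of each of them
are independent copies of `X`. -/
structure IsMeasurementEnsemble {Ω Ω' : Type*} [MeasurableSpace Ω] [MeasurableSpace Ω']
    {m n : ℕ} (a : Fin m → Ω → EuclideanSpace ℝ (Fin n)) (μ : Measure Ω)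
    (X : Ω' → ℝ) (P : Measure Ω') : Prop where
  measurable : ∀ i, Measurable (a i)
  indep_vectors : iIndepFun a μ
  indep_coords : ∀ i, iIndepFun (fun (j : Fin n) (ω : Ω) => a i ω j) μ
  copies : ∀ i j, IdentDistrib (fun ω => a i ω j) X μ P

/-- The σ-algebra generated by the whole family `a 0, …, a (m-1)`. -/
abbrev sigmaOf {Ω : Type*} {m n : ℕ} (a : Fin m → Ω → EuclideanSpace ℝ (Fin n)) :
    MeasurableSpace Ω :=
  MeasurableSpace.comap (fun ω i => a i ω) inferInstance

/-- The generalized linear model: the `y i` take values in `{-1, 1}`, are conditionally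
independent given all the measurement vectors, and, given all the measurement vectors, `y i` has
conditional mean `θ (⟨a i, x⟩)`. -/
structure IsMeasurementModel {Ω : Type*} [MeasurableSpace Ω] {m n : ℕ}
    (a : Fin m → Ω → EuclideanSpace ℝ (Fin n)) (x : EuclideanSpace ℝ (Fin n)) (θ : ℝ → ℝ)
    (y : Fin m → Ω → ℝ) (μ : Measure Ω) : Prop where
  measurable : ∀ i, Measurable (y i)
  one_bit : ∀ i ω, y i ω = -1 ∨ y i ω = 1
  cond_mean : ∀ i, μ[y i | sigmaOf a] =ᵐ[μ] fun ω => θ (inner ℝ (a i ω) x)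
  cond_indep : ∀ B : Fin m → Set ℝ, (∀ i, MeasurableSet (B i)) →
    μ[(⋂ i, y i ⁻¹' B i).indicator (fun _ => (1 : ℝ)) | sigmaOf a] =ᵐ[μ]
      fun ω => ∏ i, (μ[(y i ⁻¹' B i).indicator (fun _ => (1 : ℝ)) | sigmaOf a]) ω

/-- The rescaled objective `f_x(z) = (1/m) ∑ᵢ yᵢ ⟨aᵢ, z⟩`, as a random function; its dependence
on `x` is through the measurements `y`. -/
noncomputable def objective {Ω : Type*} {m n : ℕ} (a : Fin m → Ω → EuclideanSpace ℝ (Fin n))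
    (y : Fin m → Ω → ℝ) (z : EuclideanSpace ℝ (Fin n)) (ω : Ω) : ℝ :=
  (1 / (m : ℝ)) * ∑ i, y i ω * inner ℝ (a i ω) z

end OneBitCS

/-! Since `f_x` is linear in `z`, the supremum in question is the support function of `T = K - K` at
the single random vector `m⁻¹ ∑ (yᵢ aᵢ - E yᵢ aᵢ)`. The plan is to dominate this sum, in the convex
order, by a Gaussian vector `D g` with `D = 40 e κ √m`, and then to apply Chernoff's bound with the
convex test function `exp (l * supportFun T ·)`. No chaining or comparison of processes is needed.

Domination: conditionally on the `aᵢ` the law of `yᵢ` depends on `aᵢ` alone, so the pairs `(aᵢ, yᵢ)`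
are independent (`iIndepFun_pair`). Each centered `yᵢ aᵢ` is dominated by `2 aᵢ` because `aᵢ` is
symmetric (`ConvexDom.centered_sign_smul`). Each coordinate of `aᵢ` has tails at most 20 times those
of `eκ` times a standard Gaussian, and a factor in the tails can be traded for a dilation
(`ConvexDom.of_tail_le`). Convex domination passes to independent sums (`ConvexDom.finset_sum`),
used over the coordinates and over `i`.

Concentration: `integral_exp_supportFun_le` bounds the exponential moments of `supportFun T g` by
interpolating between two independent Gaussians through one intermediate rotation, which yields an
inequality between the moment and a smaller power of itself. -/

/-! ### Convex domination: stability properties and symmetrization. -/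

/-- `ν` is dominated by `ν'` in the convex order, tested on nonnegative continuous convex
functions. -/
def ConvexDom {E : Type*} [NormedAddCommGroup E] [NormedSpace ℝ E] [MeasurableSpace E]
    (ν ν' : Measure E) : Prop :=
  ∀ Φ : E → ℝ, ConvexOn ℝ Set.univ Φ → Continuous Φ → (∀ x, 0 ≤ Φ x) →
    ∫⁻ x, ENNReal.ofReal (Φ x) ∂ν ≤ ∫⁻ x, ENNReal.ofReal (Φ x) ∂ν'

namespace ConvexDom

section

variable {E F : Type*} [NormedAddCommGroup E] [NormedSpace ℝ E] [MeasurableSpace E]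
  [NormedAddCommGroup F] [NormedSpace ℝ F] [MeasurableSpace F] [BorelSpace F]

theorem refl (ν : Measure E) : ConvexDom ν ν := fun _ _ _ _ => le_rfl

theorem trans {ν₁ ν₂ ν₃ : Measure E} (h : ConvexDom ν₁ ν₂) (h' : ConvexDom ν₂ ν₃) :
    ConvexDom ν₁ ν₃ :=
  fun Φ hc hΦ hn => (h Φ hc hΦ hn).trans (h' Φ hc hΦ hn)

variable [BorelSpace E]

theorem map {ν ν' : Measure E} (h : ConvexDom ν ν') (L : E →L[ℝ] F) :
    ConvexDom (ν.map L) (ν'.map L) := by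
  intro Φ hc hΦ hn
  have hm : Measurable fun x => ENNReal.ofReal (Φ x) := hΦ.measurable.ennreal_ofReal
  rw [lintegral_map hm L.continuous.measurable, lintegral_map hm L.continuous.measurable]
  refine h (fun x => Φ (L x)) ?_ (hΦ.comp L.continuous) fun x => hn _
  simpa [Function.comp_def] using hc.comp_linearMap L.toLinearMap

theorem conv [SecondCountableTopology E] {ν₁ ν₁' ν₂ ν₂' : Measure E} [SFinite ν₁] [SFinite ν₁']
    [SFinite ν₂] [SFinite ν₂'] (h₁ : ConvexDom ν₁ ν₁') (h₂ : ConvexDom ν₂ ν₂') :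
    ConvexDom (ν₁ ∗ ν₂) (ν₁' ∗ ν₂') := by
  intro Φ hc hΦ hn
  have hm : Measurable fun x => ENNReal.ofReal (Φ x) := hΦ.measurable.ennreal_ofReal
  have key : ∀ x : E, ConvexOn ℝ Set.univ fun y => Φ (x + y) := fun x => by
    simpa [Function.comp_def] using hc.translate_right x
  rw [Measure.lintegral_conv hm, Measure.lintegral_conv hm]
  calc ∫⁻ x, ∫⁻ y, ENNReal.ofReal (Φ (x + y)) ∂ν₂ ∂ν₁
      ≤ ∫⁻ x, ∫⁻ y, ENNReal.ofReal (Φ (x + y)) ∂ν₂' ∂ν₁ :=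
        lintegral_mono fun x => h₂ _ (key x) (by fun_prop) fun y => hn _
    _ = ∫⁻ y, ∫⁻ x, ENNReal.ofReal (Φ (y + x)) ∂ν₁ ∂ν₂' := by
        rw [lintegral_lintegral_swap (by fun_prop)]
        simp_rw [add_comm]
    _ ≤ ∫⁻ y, ∫⁻ x, ENNReal.ofReal (Φ (y + x)) ∂ν₁' ∂ν₂' :=
        lintegral_mono fun x => h₁ _ (key x) (by fun_prop) fun y => hn _
    _ = ∫⁻ x, ∫⁻ y, ENNReal.ofReal (Φ (x + y)) ∂ν₂' ∂ν₁' := by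
        rw [lintegral_lintegral_swap (by fun_prop)]
        simp_rw [add_comm]

/-- Convex domination is preserved by sums of independent random vectors. -/
theorem finset_sum [SecondCountableTopology E] {ι Ω Ω' : Type*} [MeasurableSpace Ω]
    [MeasurableSpace Ω'] {μ : Measure Ω} {μ' : Measure Ω'} [IsProbabilityMeasure μ]
    [IsProbabilityMeasure μ'] {V : ι → Ω → E} {W : ι → Ω' → E} (hV : ∀ i, Measurable (V i))
    (hW : ∀ i, Measurable (W i)) (iV : iIndepFun V μ) (iW : iIndepFun W μ')
    (h : ∀ i, ConvexDom (μ.map (V i)) (μ'.map (W i))) (s : Finset ι) :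
    ConvexDom (μ.map (∑ i ∈ s, V i)) (μ'.map (∑ i ∈ s, W i)) := by
  classical
  induction s using Finset.induction_on with
  | empty =>
    have e1 : μ.map (0 : Ω → E) = Measure.dirac 0 := by
      rw [show (0 : Ω → E) = fun _ => 0 from rfl, Measure.map_const]; simp
    have e2 : μ'.map (0 : Ω' → E) = Measure.dirac 0 := by
      rw [show (0 : Ω' → E) = fun _ => 0 from rfl, Measure.map_const]; simp
    rw [Finset.sum_empty, Finset.sum_empty, e1, e2]
    exact refl _
  | insert i s hi ih =>
    have mV : Measurable (∑ j ∈ s, V j) := by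
      convert Finset.measurable_sum s fun j _ => hV j
      simp
    have mW : Measurable (∑ j ∈ s, W j) := by
      convert Finset.measurable_sum s fun j _ => hW j
      simp
    rw [Finset.sum_insert hi, Finset.sum_insert hi, add_comm (V i), add_comm (W i),
      (iV.indepFun_finsetSum_of_notMem hV hi).map_add_eq_map_conv_map mV (hV i),
      (iW.indepFun_finsetSum_of_notMem hW hi).map_add_eq_map_conv_map mW (hW i)]
    exact ih.conv (h i)

/-- Symmetrization: if `a` is symmetric and `y` takes values in `{-1, 1}`, then the centered vector
`y • a - E (y • a)` is dominated by `2 • a`. -/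
theorem centered_sign_smul [CompleteSpace E] [SecondCountableTopology E] {Ω : Type*}
    [MeasurableSpace Ω] {μ : Measure Ω} [IsProbabilityMeasure μ] {a : Ω → E} {y : Ω → ℝ}
    (ma : Measurable a) (my : Measurable y) (ia : Integrable a μ)
    (hy : ∀ ω, y ω = -1 ∨ y ω = 1) (ha : IdentDistrib a (fun ω => -a ω) μ μ) :
    ConvexDom (μ.map fun ω => y ω • a ω - ∫ ω', y ω' • a ω' ∂μ)
      (μ.map fun ω => (2 : ℝ) • a ω) := by
  intro Φ hc hΦ hn
  have hm : Measurable fun x => ENNReal.ofReal (Φ x) := hΦ.measurable.ennreal_ofReal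
  set v : Ω → E := fun ω => y ω • a ω with hv
  have mv : Measurable v := my.smul ma
  have iv : Integrable v μ := by
    refine ia.mono mv.aestronglyMeasurable (ae_of_all _ fun ω => ?_)
    rcases hy ω with h | h <;> simp [hv, h]
  set e : E := ∫ ω', v ω' ∂μ with he
  rw [lintegral_map hm (mv.sub_const e), lintegral_map hm (show Measurable fun ω => (2 : ℝ) • a ω by fun_prop)]
  have hsym : ∫⁻ ω, ENNReal.ofReal (Φ (-((2 : ℝ) • a ω))) ∂μ
      = ∫⁻ ω, ENNReal.ofReal (Φ ((2 : ℝ) • a ω)) ∂μ := by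
    have := (ha.comp (u := fun x => ENNReal.ofReal (Φ ((2 : ℝ) • x))) (by fun_prop)).lintegral_eq
    simpa using this.symm
  -- The sign `y ω` only permutes the two points `±2 a ω`, whatever its dependence on `a`.
  have hpair : ∀ ω, ENNReal.ofReal (Φ ((2 : ℝ) • v ω)) + ENNReal.ofReal (Φ (-((2 : ℝ) • v ω)))
      = ENNReal.ofReal (Φ ((2 : ℝ) • a ω)) + ENNReal.ofReal (Φ (-((2 : ℝ) • a ω))) := by
    intro ω
    rcases hy ω with h | h
    · simp [hv, h, add_comm]
    · simp [hv, h]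
  -- Jensen's inequality; if the right side is not integrable it is infinite and the bound is
  -- trivial.
  have hJ : ENNReal.ofReal (Φ (-((2 : ℝ) • e)))
      ≤ ∫⁻ ω, ENNReal.ofReal (Φ (-((2 : ℝ) • v ω))) ∂μ := by
    set Ψ : E → ℝ := fun x => Φ (-((2 : ℝ) • x)) with hΨ
    have cΨ : ConvexOn ℝ Set.univ Ψ := by
      have := hc.comp_linearMap ((-2 : ℝ) • LinearMap.id : E →ₗ[ℝ] E)
      simpa [hΨ, Function.comp_def] using this
    have kΨ : Continuous Ψ := by fun_prop
    change ENNReal.ofReal (Ψ e) ≤ ∫⁻ ω, ENNReal.ofReal (Ψ (v ω)) ∂μ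
    by_cases hI : Integrable (fun ω => Ψ (v ω)) μ
    · rw [← ofReal_integral_eq_lintegral_ofReal hI (ae_of_all _ fun ω => hΨ ▸ hn _)]
      exact ENNReal.ofReal_le_ofReal (cΨ.map_integral_le kΨ.continuousOn isClosed_univ
        (ae_of_all _ fun _ => Set.mem_univ _) iv hI)
    · have : ∫⁻ ω, ENNReal.ofReal (Ψ (v ω)) ∂μ = ∞ := by
        by_contra hne
        refine hI ⟨(kΨ.measurable.comp mv).aestronglyMeasurable, ?_⟩
        rw [hasFiniteIntegral_iff_ofReal (ae_of_all _ fun ω => hΨ ▸ hn _)]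
        exact lt_top_iff_ne_top.2 hne
      exact this ▸ le_top
  -- `v - e` is the midpoint of `2v` and `-2e`.
  have hpt : ∀ ω, ENNReal.ofReal (Φ (v ω - e)) ≤
      2⁻¹ * ENNReal.ofReal (Φ ((2 : ℝ) • v ω)) + 2⁻¹ * ENNReal.ofReal (Φ (-((2 : ℝ) • e))) := by
    intro ω
    have h1 := hc.2 (Set.mem_univ ((2 : ℝ) • v ω)) (Set.mem_univ (-((2 : ℝ) • e)))
      (by norm_num : (0 : ℝ) ≤ 1 / 2) (by norm_num : (0 : ℝ) ≤ 1 / 2) (by norm_num)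
    have h2 : (1 / 2 : ℝ) • (2 : ℝ) • v ω + (1 / 2 : ℝ) • -((2 : ℝ) • e) = v ω - e := by
      module
    rw [h2] at h1
    have h3 : (2⁻¹ : ℝ≥0∞) = ENNReal.ofReal (1 / 2) := by
      rw [one_div, ENNReal.ofReal_inv_of_pos (by norm_num)]; norm_num
    rw [h3, ← ENNReal.ofReal_mul (by norm_num), ← ENNReal.ofReal_mul (by norm_num),
      ← ENNReal.ofReal_add (by have := hn ((2 : ℝ) • v ω); positivity)
        (by have := hn (-((2 : ℝ) • e)); positivity)]
    exact ENNReal.ofReal_le_ofReal (by simpa using h1)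
  have m1 : Measurable fun ω => ENNReal.ofReal (Φ ((2 : ℝ) • v ω)) := by fun_prop
  have m2 : Measurable fun ω => ENNReal.ofReal (Φ ((2 : ℝ) • a ω)) := by fun_prop
  calc ∫⁻ ω, ENNReal.ofReal (Φ (v ω - e)) ∂μ
      ≤ ∫⁻ ω, (2⁻¹ * ENNReal.ofReal (Φ ((2 : ℝ) • v ω))
          + 2⁻¹ * ENNReal.ofReal (Φ (-((2 : ℝ) • e)))) ∂μ := lintegral_mono hpt
    _ = 2⁻¹ * (∫⁻ ω, ENNReal.ofReal (Φ ((2 : ℝ) • v ω)) ∂μ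
          + ENNReal.ofReal (Φ (-((2 : ℝ) • e)))) := by
        rw [lintegral_add_right _ measurable_const, lintegral_const_mul _ m1]
        simp [mul_add]
    _ ≤ 2⁻¹ * (∫⁻ ω, ENNReal.ofReal (Φ ((2 : ℝ) • v ω)) ∂μ
          + ∫⁻ ω, ENNReal.ofReal (Φ (-((2 : ℝ) • v ω))) ∂μ) := by gcongr
    _ = 2⁻¹ * (∫⁻ ω, ENNReal.ofReal (Φ ((2 : ℝ) • a ω)) ∂μ
          + ∫⁻ ω, ENNReal.ofReal (Φ (-((2 : ℝ) • a ω))) ∂μ) := by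
        rw [← lintegral_add_left m1, ← lintegral_add_left m2]
        simp_rw [hpair]
    _ = ∫⁻ ω, ENNReal.ofReal (Φ ((2 : ℝ) • a ω)) ∂μ := by
        rw [hsym, ← two_mul, ← mul_assoc, ENNReal.inv_mul_cancel (by norm_num) (by norm_num),
          one_mul]

end

end ConvexDom

/-! ### From moment growth to Gaussian domination in dimension one. -/

theorem lintegral_abs_rpow_le {Ω : Type*} [MeasurableSpace Ω] {X : Ω → ℝ} {P : Measure Ω}
    (hX : OneBitCS.subgaussianNorm X P < ∞) {p : ℝ} (hp : 1 ≤ p) :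
    ∫⁻ ω, ENNReal.ofReal (|X ω| ^ p) ∂P ≤
      ENNReal.ofReal (((OneBitCS.subgaussianNorm X P).toReal * p ^ (1 / 2 : ℝ)) ^ p) := by
  set κ := (OneBitCS.subgaussianNorm X P).toReal with hκ
  have hp0 : 0 < p := by linarith
  set I := ∫⁻ ω, ENNReal.ofReal (|X ω| ^ p) ∂P with hI
  have h1 : ENNReal.ofReal (p ^ (-(1 / 2) : ℝ)) * I ^ (1 / p) ≤ ENNReal.ofReal κ := by
    rw [hκ, ENNReal.ofReal_toReal hX.ne]
    exact le_iSup₂ (f := fun (p : ℝ) (_ : 1 ≤ p) => ENNReal.ofReal (p ^ (-(1 / 2) : ℝ)) *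
      (∫⁻ ω, ENNReal.ofReal (|X ω| ^ p) ∂P) ^ (1 / p)) p hp
  have h2 : I ^ (1 / p) ≤ ENNReal.ofReal (κ * p ^ (1 / 2 : ℝ)) := by
    have : I ^ (1 / p) = ENNReal.ofReal (p ^ (1 / 2 : ℝ)) *
        (ENNReal.ofReal (p ^ (-(1 / 2) : ℝ)) * I ^ (1 / p)) := by
      rw [← mul_assoc, ← ENNReal.ofReal_mul (by positivity), ← Real.rpow_add hp0]
      simp
    rw [this, mul_comm κ, ENNReal.ofReal_mul (by positivity)]
    gcongr
  have h3 : I = (I ^ (1 / p)) ^ p := by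
    rw [← ENNReal.rpow_mul, one_div_mul_cancel hp0.ne', ENNReal.rpow_one]
  rw [h3, ← ENNReal.ofReal_rpow_of_nonneg (by positivity) hp0.le]
  exact ENNReal.rpow_le_rpow h2 hp0.le

/-- If `κ = 0`, the first moment vanishes and `X = 0` almost everywhere, contradicting unit
variance. -/
theorem subgaussianNorm_toReal_pos {Ω : Type*} [MeasurableSpace Ω] {X : Ω → ℝ} {P : Measure Ω}
    (hX : OneBitCS.IsSymmSubgaussianUnit X P) : 0 < (OneBitCS.subgaussianNorm X P).toReal := by
  refine lt_of_le_of_ne ENNReal.toReal_nonneg fun h => ?_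
  have h1 := lintegral_abs_rpow_le hX.subgaussian le_rfl
  rw [← h] at h1
  have h2 : ∫⁻ ω, ENNReal.ofReal (|X ω| ^ (1 : ℝ)) ∂P = 0 := by simpa using h1
  rw [lintegral_eq_zero_iff (by have := hX.measurable; fun_prop)] at h2
  have h3 : X =ᵐ[P] fun _ => 0 := by
    filter_upwards [h2] with ω hω
    simpa using hω
  have h4 := hX.unit_variance
  rw [variance_congr h3] at h4
  simp [variance, evariance] at h4

theorem integrable_of_subgaussianNorm_lt_top {Ω : Type*} [MeasurableSpace Ω] {X : Ω → ℝ}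
    {P : Measure Ω} (mX : Measurable X) (hX : OneBitCS.subgaussianNorm X P < ∞) :
    Integrable X P := by
  refine ⟨mX.aestronglyMeasurable, ?_⟩
  rw [hasFiniteIntegral_iff_norm]
  have h := lintegral_abs_rpow_le hX le_rfl
  simp only [Real.rpow_one, Real.norm_eq_abs] at h ⊢
  exact h.trans_lt ENNReal.ofReal_lt_top

/-- Sub-gaussian tail bound from the moment growth. -/
theorem measure_le_abs_le_exp {Ω : Type*} [MeasurableSpace Ω] {X : Ω → ℝ} {P : Measure Ω}
    [IsProbabilityMeasure P] (mX : Measurable X) (hX : OneBitCS.subgaussianNorm X P < ∞)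
    (hpos : 0 < (OneBitCS.subgaussianNorm X P).toReal) {s : ℝ} (hs : 0 ≤ s) :
    P {ω | Real.exp 1 * (OneBitCS.subgaussianNorm X P).toReal * s ≤ |X ω|} ≤
      ENNReal.ofReal (Real.exp (1 - s ^ 2)) := by
  set κ := (OneBitCS.subgaussianNorm X P).toReal with hκ
  rcases lt_or_ge s 1 with h | h
  · refine prob_le_one.trans ?_
    rw [← ENNReal.ofReal_one]
    exact ENNReal.ofReal_le_ofReal (Real.one_le_exp (by nlinarith))
  -- Markov's inequality for the moment of order `p = s ^ 2`, where `κ √p = κ s`: the threshold `e κ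
  -- s` gains exactly `e ^ (-p)`. The extra `e` in the statement covers `s < 1`.
  have hp : 1 ≤ s ^ 2 := by nlinarith
  have hI := lintegral_abs_rpow_le hX hp
  have hsq : (s ^ 2) ^ (1 / 2 : ℝ) = s := by
    rw [← Real.sqrt_eq_rpow, Real.sqrt_sq hs]
  rw [hsq] at hI
  have hM := mul_meas_ge_le_lintegral₀ (μ := P) (f := fun ω => ENNReal.ofReal (|X ω| ^ (s ^ 2)))
    (by fun_prop) (ENNReal.ofReal ((Real.exp 1 * κ * s) ^ (s ^ 2)))
  have hsub : {ω | Real.exp 1 * κ * s ≤ |X ω|} ⊆ {ω | ENNReal.ofReal ((Real.exp 1 * κ * s) ^ (s ^ 2))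
      ≤ ENNReal.ofReal (|X ω| ^ (s ^ 2))} := fun ω hω =>
    ENNReal.ofReal_le_ofReal (Real.rpow_le_rpow (by positivity) hω (by positivity))
  have hpp : 0 < (κ * s) ^ (s ^ 2) := by positivity
  have e1 : (Real.exp 1 * κ * s) ^ (s ^ 2) = Real.exp (s ^ 2) * (κ * s) ^ (s ^ 2) := by
    rw [mul_assoc, Real.mul_rpow (by positivity) (by positivity), ← Real.exp_mul, one_mul]
  have h5 : ENNReal.ofReal ((Real.exp 1 * κ * s) ^ (s ^ 2)) * P {ω | Real.exp 1 * κ * s ≤ |X ω|} ≤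
      ENNReal.ofReal ((κ * s) ^ (s ^ 2)) := le_trans (by gcongr) (hM.trans hI)
  rw [mul_comm, ← ENNReal.le_div_iff_mul_le (by left; simp; positivity) (by simp),
    ← ENNReal.ofReal_div_of_pos (by positivity), e1] at h5
  refine h5.trans (ENNReal.ofReal_le_ofReal ?_)
  rw [div_mul_cancel_right₀ hpp.ne', ← Real.exp_neg]
  exact Real.exp_le_exp.2 (by linarith)

/-- On `[s, s + 1]` the Gaussian density is at least `exp (-1 - s ^ 2) / √(2π)`, and `e² √(2π) ≤
20`. -/
theorem ofReal_exp_le_gaussianReal_le_abs (s : ℝ) :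
    ENNReal.ofReal (Real.exp (1 - s ^ 2)) ≤ 20 * gaussianReal 0 1 {x | s ≤ |x|} := by
  have hsub : Set.Icc s (s + 1) ⊆ {x | s ≤ |x|} := fun x hx => hx.1.trans (le_abs_self x)
  have hc : Real.exp 2 * √(2 * Real.pi) ≤ 20 := by
    have h1 : Real.exp 2 ≤ 7.4 := by
      have := Real.exp_one_lt_d9
      have h : Real.exp 2 = Real.exp 1 ^ 2 := by rw [← Real.exp_nat_mul]; norm_num
      rw [h]; nlinarith [Real.exp_pos 1]
    have h2 : √(2 * Real.pi) ≤ 2.6 := by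
      rw [Real.sqrt_le_left (by norm_num)]; nlinarith [Real.pi_lt_d2]
    have := Real.exp_pos 2
    nlinarith [Real.sqrt_nonneg (2 * Real.pi)]
  have h3 : ENNReal.ofReal (Real.exp (-1 - s ^ 2) / √(2 * Real.pi))
      ≤ gaussianReal 0 1 {x | s ≤ |x|} := by
    refine le_trans ?_ (measure_mono hsub)
    rw [gaussianReal_apply 0 one_ne_zero]
    calc ENNReal.ofReal (Real.exp (-1 - s ^ 2) / √(2 * Real.pi))
        = ∫⁻ x in Set.Icc s (s + 1), ENNReal.ofReal (Real.exp (-1 - s ^ 2) / √(2 * Real.pi)) := by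
          simp
      _ ≤ ∫⁻ x in Set.Icc s (s + 1), gaussianPDF 0 1 x := by
          refine setLIntegral_mono (measurable_gaussianPDF 0 1) fun x hx => ?_
          rw [gaussianPDF]
          refine ENNReal.ofReal_le_ofReal ?_
          rw [gaussianPDFReal, div_eq_inv_mul]
          simp only [NNReal.coe_one, mul_one, sub_zero]
          gcongr
          nlinarith [hx.1, hx.2, sq_nonneg (s - 1)]
  calc ENNReal.ofReal (Real.exp (1 - s ^ 2))
      ≤ ENNReal.ofReal (20 * (Real.exp (-1 - s ^ 2) / √(2 * Real.pi))) := by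
        refine ENNReal.ofReal_le_ofReal ?_
        rw [mul_div_assoc', le_div_iff₀ (by positivity)]
        have : Real.exp (1 - s ^ 2) = Real.exp 2 * Real.exp (-1 - s ^ 2) := by
          rw [← Real.exp_add]; ring_nf
        rw [this]
        nlinarith [Real.exp_pos (-1 - s ^ 2)]
    _ = 20 * ENNReal.ofReal (Real.exp (-1 - s ^ 2) / √(2 * Real.pi)) := by
        rw [ENNReal.ofReal_mul (by norm_num)]; norm_num
    _ ≤ _ := by gcongr

/-- A random variable whose tail is at most `k` times the tail of a symmetric `ν` has law dominated
by the `k`-fold dilation of `ν`, provided it is symmetric. -/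
theorem ConvexDom.of_tail_le {Ω : Type*} [MeasurableSpace Ω] {X : Ω → ℝ} {P : Measure Ω}
    [IsProbabilityMeasure P] (mX : Measurable X) (sX : IdentDistrib X (fun ω => -X ω) P P)
    {ν : Measure ℝ} [IsProbabilityMeasure ν] (sν : ν.map (fun x => -x) = ν) {k : ℝ} (hk : 1 ≤ k)
    (h : ∀ t, 0 ≤ t → P {ω | t ≤ |X ω|} ≤ ENNReal.ofReal k * ν {x | t ≤ |x|}) :
    ConvexDom (P.map X) (ν.map fun x => k * x) := by
  intro Φ hc hΦ hn
  have hk0 : 0 < k := by linarith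
  -- By symmetry of both laws `Φ` may be replaced by its even part, which is convex, hence
  -- nondecreasing in `|x|`.
  set ψ : ℝ → ℝ := fun x => (Φ x + Φ (-x)) / 2 with hψ
  have kψ : Continuous ψ := by fun_prop
  have cψ : ConvexOn ℝ Set.univ ψ := by
    have h1 : ConvexOn ℝ Set.univ fun x => Φ (-x) := by
      simpa [Function.comp_def] using hc.comp_linearMap (-LinearMap.id : ℝ →ₗ[ℝ] ℝ)
    have := (hc.add h1).smul (c := (1 / 2 : ℝ)) (by norm_num)
    refine (?_ : ψ = fun x => (1 / 2 : ℝ) • (Φ x + Φ (-x))) ▸ this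
    ext x
    simp only [hψ, smul_eq_mul]; ring
  have nψ : ∀ x, 0 ≤ ψ x := fun x => by have := hn x; have := hn (-x); positivity
  have eψ : ∀ x, ψ (-x) = ψ x := fun x => by simp [hψ, add_comm]
  have hsplit : ∀ Q : Measure ℝ, Q.map (fun x => -x) = Q →
      ∫⁻ x, ENNReal.ofReal (Φ x) ∂Q = ∫⁻ x, ENNReal.ofReal (ψ x) ∂Q := by
    intro Q sQ
    have h1 : ∫⁻ x, ENNReal.ofReal (Φ x) ∂Q = ∫⁻ x, ENNReal.ofReal (Φ (-x)) ∂Q := by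
      conv_lhs => rw [← sQ]
      exact lintegral_map (by fun_prop) (by fun_prop)
    have h2 : ∀ x, ENNReal.ofReal (ψ x) =
        2⁻¹ * (ENNReal.ofReal (Φ x) + ENNReal.ofReal (Φ (-x))) := by
      intro x
      have h3 : (2⁻¹ : ℝ≥0∞) = ENNReal.ofReal 2⁻¹ := by
        rw [ENNReal.ofReal_inv_of_pos (by norm_num)]; norm_num
      rw [← ENNReal.ofReal_add (hn _) (hn _), h3, ← ENNReal.ofReal_mul (by norm_num), hψ]
      simp only [div_eq_inv_mul]
    simp_rw [h2]
    rw [lintegral_const_mul _ (by fun_prop), lintegral_add_left (by fun_prop), ← h1, ← two_mul,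
      ← mul_assoc, ENNReal.inv_mul_cancel (by norm_num) (by norm_num), one_mul]
  have hmono : ∀ {x z : ℝ}, |x| ≤ |z| → ψ x ≤ ψ z := by
    intro x z hxz
    have hs : x ∈ segment ℝ (-|z|) |z| := by
      rw [segment_eq_Icc (by linarith [abs_nonneg z])]
      exact abs_le.1 hxz
    have h1 := cψ.le_on_segment (Set.mem_univ _) (Set.mem_univ _) hs
    rw [eψ, max_self] at h1
    rcases abs_choice z with h2 | h2 <;> rw [h2] at h1
    · exact h1
    · rwa [eψ] at h1
  set g : ℝ → ℝ := fun x => ψ (k * x) - ψ 0 with hg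
  have g0 : ∀ x, 0 ≤ g x := fun x => sub_nonneg.2 (hmono (by rw [abs_zero]; exact abs_nonneg _))
  have kg : Continuous g := by fun_prop
  -- Convexity between `0` and `k x`: dilating by `k` multiplies the growth above `ψ 0` by at least
  -- `k`, which pays for the factor `k` in the tails.
  have hcontr : ∀ x, ψ x ≤ ψ 0 + k⁻¹ * g x := by
    intro x
    have h1 := cψ.2 (Set.mem_univ (k * x)) (Set.mem_univ 0) 
      (by positivity : 0 ≤ k⁻¹) (sub_nonneg.2 (inv_le_one_of_one_le₀ hk)) (by ring)
    have h2 : k⁻¹ • (k * x) + (1 - k⁻¹) • (0 : ℝ) = x := by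
      simp only [smul_eq_mul]; field_simp; ring
    rw [h2] at h1
    simp only [smul_eq_mul] at h1
    simp only [hg]; linarith
  have htail : ∀ t, 0 < t → P {ω | t ≤ g (X ω)} ≤ ENNReal.ofReal k * ν {x | t ≤ g x} := by
    intro t ht
    -- The superlevel set of `g` is either empty or of the form `|x| ≥ r₀`, so the tail hypothesis
    -- applies to it.
    set S : Set ℝ := {r | 0 ≤ r ∧ t ≤ g r} with hS
    rcases S.eq_empty_or_nonempty with hE | hne
    · have : {ω | t ≤ g (X ω)} = ∅ := by
        ext ω
        simp only [Set.mem_ofPred_eq, Set.mem_empty_iff_false, iff_false]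
        intro hω
        have : |X ω| ∈ S := ⟨abs_nonneg _, hω.trans (by
          simp only [hg]; gcongr; exact hmono (by simp [abs_mul]))⟩
        rw [hE] at this; exact this
      rw [this]; simp
    · have hcl : IsClosed S := isClosed_Ici.inter (isClosed_le continuous_const kg)
      have hbb : BddBelow S := ⟨0, fun r hr => hr.1⟩
      have hmem := hcl.csInf_mem hne hbb
      set r₀ := sInf S
      have hset : ∀ x, t ≤ g x ↔ r₀ ≤ |x| := by
        intro x
        constructor
        · intro hx
          refine csInf_le hbb ⟨abs_nonneg _, hx.trans ?_⟩
          simp only [hg]; gcongr; exact hmono (by simp [abs_mul])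
        · intro hx
          refine hmem.2.trans ?_
          simp only [hg]; gcongr
          refine hmono ?_
          rw [abs_mul, abs_mul, abs_of_nonneg hmem.1]
          gcongr
      simp_rw [hset]
      exact h r₀ hmem.1
  have hlc : ∫⁻ ω, ENNReal.ofReal (g (X ω)) ∂P ≤
      ENNReal.ofReal k * ∫⁻ x, ENNReal.ofReal (g x) ∂ν := by
    -- Layer-cake formula on both sides.
    rw [lintegral_eq_lintegral_meas_le P (ae_of_all _ fun ω => g0 _) (by fun_prop),
      lintegral_eq_lintegral_meas_le ν (ae_of_all _ fun ω => g0 _) (by fun_prop),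
      ← lintegral_const_mul' _ _ ENNReal.ofReal_ne_top]
    exact setLIntegral_mono' measurableSet_Ioi fun t ht => htail t ht
  have hm : Measurable fun x => ENNReal.ofReal (Φ x) := hΦ.measurable.ennreal_ofReal
  have hmψ : Measurable fun x => ENNReal.ofReal (ψ x) := kψ.measurable.ennreal_ofReal
  have sν' : (ν.map fun x => k * x).map (fun x => -x) = ν.map fun x => k * x := by
    conv_rhs => rw [← sν]
    rw [Measure.map_map (by fun_prop) (by fun_prop), Measure.map_map (by fun_prop) (by fun_prop)]
    congr 1
    ext x; simp
  have sX' : (P.map X).map (fun x => -x) = P.map X := by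
    rw [Measure.map_map (by fun_prop) mX]
    exact sX.map_eq.symm
  rw [hsplit _ sX', hsplit _ sν', lintegral_map hmψ mX, lintegral_map hmψ (by fun_prop)]
  calc ∫⁻ ω, ENNReal.ofReal (ψ (X ω)) ∂P
      ≤ ∫⁻ ω, (ENNReal.ofReal (ψ 0) + ENNReal.ofReal k⁻¹ * ENNReal.ofReal (g (X ω))) ∂P := by
        refine lintegral_mono fun ω => ?_
        rw [← ENNReal.ofReal_mul (by positivity), ← ENNReal.ofReal_add (nψ 0)
          (mul_nonneg (by positivity) (g0 _))]
        exact ENNReal.ofReal_le_ofReal (hcontr _)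
    _ = ENNReal.ofReal (ψ 0) + ENNReal.ofReal k⁻¹ * ∫⁻ ω, ENNReal.ofReal (g (X ω)) ∂P := by
        rw [lintegral_add_left measurable_const, lintegral_const_mul _ (by fun_prop)]
        simp
    _ ≤ ENNReal.ofReal (ψ 0) + ENNReal.ofReal k⁻¹ * (ENNReal.ofReal k *
          ∫⁻ x, ENNReal.ofReal (g x) ∂ν) := by gcongr
    _ = ∫⁻ x, (ENNReal.ofReal (ψ 0) + ENNReal.ofReal (g x)) ∂ν := by
        rw [lintegral_add_left measurable_const, ← mul_assoc, ← ENNReal.ofReal_mul (by positivity),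
          inv_mul_cancel₀ hk0.ne']
        simp
    _ = ∫⁻ x, ENNReal.ofReal (ψ (k * x)) ∂ν := by
        refine lintegral_congr fun x => ?_
        rw [← ENNReal.ofReal_add (nψ 0) (g0 x)]
        simp [hg]

/-- A symmetric sub-gaussian random variable is dominated by a multiple of a standard Gaussian. -/
theorem ConvexDom.gaussianReal_of_subgaussian {Ω : Type*} [MeasurableSpace Ω] {X : Ω → ℝ}
    {P : Measure Ω} [IsProbabilityMeasure P] (hX : OneBitCS.IsSymmSubgaussianUnit X P) :
    ConvexDom (P.map X) ((gaussianReal 0 1).map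
      fun x => 20 * Real.exp 1 * (OneBitCS.subgaussianNorm X P).toReal * x) := by
  set κ := (OneBitCS.subgaussianNorm X P).toReal with hκ
  have hpos : 0 < κ := subgaussianNorm_toReal_pos hX
  have hc : 0 < Real.exp 1 * κ := by positivity
  have mm : Measurable fun x : ℝ => Real.exp 1 * κ * x := by fun_prop
  have : IsProbabilityMeasure ((gaussianReal 0 1).map fun x => Real.exp 1 * κ * x) :=
    Measure.isProbabilityMeasure_map mm.aemeasurable
  have hsym : ((gaussianReal 0 1).map fun x => Real.exp 1 * κ * x).map (fun x => -x)
      = (gaussianReal 0 1).map fun x => Real.exp 1 * κ * x := by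
    rw [gaussianReal_map_const_mul, gaussianReal_map_neg]; simp
  have h := ConvexDom.of_tail_le hX.measurable hX.symmetric hsym (k := 20) (by norm_num) ?_
  · rw [Measure.map_map (by fun_prop) mm] at h
    convert h using 2
    ext x; simp; ring
  · intro t ht
    rw [Measure.map_apply mm (measurableSet_le measurable_const (by fun_prop))]
    have h1 := measure_le_abs_le_exp hX.measurable hX.subgaussian hpos (s := t / (Real.exp 1 * κ))
      (by positivity)
    rw [← hκ, mul_div_cancel₀ _ hc.ne'] at h1
    refine (h1.trans (ofReal_exp_le_gaussianReal_le_abs _)).trans_eq ?_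
    norm_num
    congr 2
    ext x
    simp [abs_of_pos hpos, div_le_iff₀' hc]

/-! ### Support functions of bounded sets. -/

/-- The support function `u ↦ sup_{z ∈ T} ⟨u, z⟩`. -/
noncomputable def supportFun {E : Type*} [NormedAddCommGroup E] [InnerProductSpace ℝ E]
    (T : Set E) (u : E) : ℝ :=
  ⨆ z : ↥T, inner ℝ u (z : E)

section supportFun

variable {E : Type*} [NormedAddCommGroup E] [InnerProductSpace ℝ E] {T : Set E} {R : ℝ}

/-- A real `⨆` over an unbounded family defaults to `0`; this bound makes `supportFun` a genuine
supremum. -/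
theorem bddAbove_inner (hT : T ⊆ Metric.closedBall 0 R) (u : E) :
    BddAbove (Set.range fun z : ↥T => inner ℝ u (z : E)) := by
  refine ⟨‖u‖ * R, ?_⟩
  rintro _ ⟨z, rfl⟩
  have := mem_closedBall_zero_iff.1 (hT z.2)
  exact (real_inner_le_norm _ _).trans (by gcongr)

theorem inner_le_supportFun (hT : T ⊆ Metric.closedBall 0 R) (u : E) {z : E} (hz : z ∈ T) :
    inner ℝ u z ≤ supportFun T u :=
  le_ciSup (bddAbove_inner hT u) ⟨z, hz⟩

theorem supportFun_nonneg (hT : T ⊆ Metric.closedBall 0 R) (h0 : (0 : E) ∈ T) (u : E) :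
    0 ≤ supportFun T u := by
  simpa using inner_le_supportFun hT u h0

theorem supportFun_le_add (hT : T ⊆ Metric.closedBall 0 R) (h0 : (0 : E) ∈ T) (u v : E) :
    supportFun T (u + v) ≤ supportFun T u + supportFun T v := by
  have : Nonempty ↥T := ⟨⟨0, h0⟩⟩
  refine ciSup_le fun z => ?_
  rw [inner_add_left]
  exact add_le_add (inner_le_supportFun hT u z.2) (inner_le_supportFun hT v z.2)

theorem supportFun_smul {c : ℝ} (hc : 0 ≤ c) (u : E) :
    supportFun T (c • u) = c * supportFun T u := by
  simp only [supportFun, real_inner_smul_left]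
  rw [Real.mul_iSup_of_nonneg hc]

theorem supportFun_le_mul_norm (hT : T ⊆ Metric.closedBall 0 R) (h0 : (0 : E) ∈ T) (u : E) :
    supportFun T u ≤ R * ‖u‖ := by
  have : Nonempty ↥T := ⟨⟨0, h0⟩⟩
  refine ciSup_le fun z => ?_
  have := mem_closedBall_zero_iff.1 (hT z.2)
  rw [mul_comm]
  exact (real_inner_le_norm _ _).trans (by gcongr)

theorem convexOn_supportFun (hT : T ⊆ Metric.closedBall 0 R) (h0 : (0 : E) ∈ T) :
    ConvexOn ℝ Set.univ (supportFun T) := by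
  refine ⟨convex_univ, fun u _ v _ a b ha hb _ => ?_⟩
  refine (supportFun_le_add hT h0 _ _).trans_eq ?_
  rw [supportFun_smul ha, supportFun_smul hb]; rfl

theorem continuous_supportFun (hT : T ⊆ Metric.closedBall 0 R) (h0 : (0 : E) ∈ T) :
    Continuous (supportFun T) := by
  have hR : 0 ≤ R := by simpa using hT h0
  refine (LipschitzWith.of_le_add_mul R.toNNReal fun u v => ?_).continuous
  have h1 := supportFun_le_add hT h0 v (u - v)
  have h2 := supportFun_le_mul_norm hT h0 (u - v)
  rw [add_sub_cancel] at h1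
  rw [Real.coe_toNNReal R hR, dist_eq_norm]
  linarith

end supportFun

/-! ### Exponential moments of the support function of a Gaussian vector. -/

section Gaussian

variable {E : Type*} [NormedAddCommGroup E] [InnerProductSpace ℝ E] [FiniteDimensional ℝ E]
  [MeasurableSpace E] [BorelSpace E] {T : Set E} {R : ℝ}

theorem map_inner_stdGaussian (z : E) :
    (stdGaussian E).map (fun g => inner ℝ z g) = gaussianReal 0 (‖z‖₊ ^ 2) := by
  have h := IsGaussian.map_eq_gaussianReal (μ := stdGaussian E) (innerSL ℝ z)
  rw [integral_strongDual_stdGaussian, variance_dual_stdGaussian, innerSL_apply_norm] at h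
  have e : (‖z‖ ^ 2).toNNReal = ‖z‖₊ ^ 2 := by ext; simp
  rw [e] at h
  exact h

theorem lintegral_exp_inner_stdGaussian (z : E) :
    ∫⁻ g, ENNReal.ofReal (Real.exp (inner ℝ z g)) ∂(stdGaussian E) =
      ENNReal.ofReal (Real.exp (‖z‖ ^ 2 / 2)) := by
  have h1 : ∫⁻ x, ENNReal.ofReal (Real.exp x) ∂(gaussianReal 0 (‖z‖₊ ^ 2)) =
      ENNReal.ofReal (Real.exp (‖z‖ ^ 2 / 2)) := by
    have hi : Integrable (fun x => Real.exp x) (gaussianReal 0 (‖z‖₊ ^ 2)) := by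
      simpa using integrable_exp_mul_gaussianReal (μ := 0) (v := ‖z‖₊ ^ 2) 1
    rw [← ofReal_integral_eq_lintegral_ofReal hi (ae_of_all _ fun x => (Real.exp_pos x).le)]
    have := congrFun (mgf_id_gaussianReal (μ := 0) (v := ‖z‖₊ ^ 2)) 1
    simp only [mgf, id, one_mul] at this
    rw [this]; simp
  rw [← h1, ← map_inner_stdGaussian, lintegral_map (by fun_prop) (by fun_prop)]

theorem integrable_exp_mul_norm_stdGaussian (c : ℝ) :
    Integrable (fun g => Real.exp (c * ‖g‖)) (stdGaussian E) := by
  -- Fernique's theorem; completing the square then gives `c‖g‖ ≤ c² / (4C) + C‖g‖²`.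
  obtain ⟨C, hC, hi⟩ := IsGaussian.exists_integrable_exp_sq (stdGaussian E)
  refine (hi.const_mul (Real.exp (c ^ 2 / (4 * C)))).mono (by fun_prop) (ae_of_all _ fun g => ?_)
  rw [Real.norm_of_nonneg (by positivity), Real.norm_of_nonneg (by positivity), ← Real.exp_add]
  refine Real.exp_le_exp.2 ?_
  have : c ^ 2 / (4 * C) + C * ‖g‖ ^ 2 - c * ‖g‖ = (c - 2 * C * ‖g‖) ^ 2 / (4 * C) := by
    field_simp; ring
  have h2 : 0 ≤ (c - 2 * C * ‖g‖) ^ 2 / (4 * C) := by positivity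
  linarith

theorem integrable_supportFun (hT : T ⊆ Metric.closedBall 0 R) (h0 : (0 : E) ∈ T) :
    Integrable (supportFun T) (stdGaussian E) := by
  refine ((IsGaussian.integrable_id (μ := stdGaussian E)).norm.const_mul R).mono
    (continuous_supportFun hT h0).aestronglyMeasurable (ae_of_all _ fun g => ?_)
  rw [Real.norm_of_nonneg (supportFun_nonneg hT h0 g)]
  exact (supportFun_le_mul_norm hT h0 g).trans (le_abs_self _)

theorem integrable_exp_supportFun (hT : T ⊆ Metric.closedBall 0 R) (h0 : (0 : E) ∈ T) {l : ℝ}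
    (hl : 0 ≤ l) : Integrable (fun g => Real.exp (l * supportFun T g)) (stdGaussian E) := by
  have := (continuous_supportFun hT h0)
  refine (integrable_exp_mul_norm_stdGaussian (l * R)).mono
    (by fun_prop) (ae_of_all _ fun g => ?_)
  rw [Real.norm_of_nonneg (by positivity), Real.norm_of_nonneg (by positivity)]
  refine Real.exp_le_exp.2 ?_
  rw [mul_assoc]
  exact mul_le_mul_of_nonneg_left (supportFun_le_mul_norm hT h0 g) hl

theorem lintegral_prod_rotation_stdGaussian (θ : ℝ) {f : E × E → ℝ≥0∞} (hf : Measurable f) :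
    ∫⁻ p : E × E, f (Real.cos θ • p.1 + Real.sin θ • p.2, -Real.sin θ • p.1 + Real.cos θ • p.2)
      ∂((stdGaussian E).prod (stdGaussian E)) =
    ∫⁻ p, f p ∂((stdGaussian E).prod (stdGaussian E)) := by
  have h := IsGaussian.map_rotation_eq_self (μ := stdGaussian E)
    (by simp) θ
  conv_rhs => rw [← h]
  rw [lintegral_map hf (ContinuousLinearMap.continuous _).measurable]
  rfl

/-- One step of the Maurey-Pisier interpolation: the increment of the support function under a
rotation by `-π/4` has small exponential moments. -/
theorem lintegral_exp_supportFun_sub_le (hT : T ⊆ Metric.closedBall 0 R) (h0 : (0 : E) ∈ T)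
    {l : ℝ} (hl : 0 ≤ l) :
    ∫⁻ p : E × E, ENNReal.ofReal (Real.exp (2 * l *
        (supportFun T p.1 - supportFun T ((√2 / 2) • (p.1 - p.2)))))
        ∂((stdGaussian E).prod (stdGaussian E)) ≤
      ENNReal.ofReal (Real.exp (l ^ 2 * R ^ 2)) *
        ∫⁻ g, ENNReal.ofReal (Real.exp ((2 - √2) * l * supportFun T g)) ∂(stdGaussian E) := by
  have hk := continuous_supportFun hT h0
  have : Nonempty ↥T := ⟨⟨0, h0⟩⟩
  have hs2 : √2 ^ 2 = 2 := Real.sq_sqrt (by norm_num)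
  rw [lintegral_prod _ (by fun_prop), ← lintegral_const_mul _ (by fun_prop)]
  refine lintegral_mono fun x => ?_
  rw [← ENNReal.ofReal_mul (by positivity), ← Real.exp_add]
  -- Testing the second support function at the same `z` leaves `(2 - √2) l ⟨x, z⟩ + √2 l ⟨z, y⟩`.
  -- The first term is at most `(2 - √2) l * supportFun T x`, the second is Gaussian in `y` with
  -- variance `2 l² ‖z‖²`.
  have key : ∀ z ∈ T, ∫⁻ y, ENNReal.ofReal (Real.exp (2 * l *
      (inner ℝ x z - supportFun T ((√2 / 2) • (x - y))))) ∂(stdGaussian E) ≤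
      ENNReal.ofReal (Real.exp (l ^ 2 * R ^ 2 + (2 - √2) * l * supportFun T x)) := by
    intro z hz
    have hzR := mem_closedBall_zero_iff.1 (hT hz)
    calc _ ≤ ∫⁻ y, ENNReal.ofReal (Real.exp ((2 - √2) * l * supportFun T x)) *
          ENNReal.ofReal (Real.exp (inner ℝ ((√2 * l) • z) y)) ∂(stdGaussian E) := by
          refine lintegral_mono fun y => ?_
          rw [← ENNReal.ofReal_mul (by positivity), ← Real.exp_add]
          refine ENNReal.ofReal_le_ofReal (Real.exp_le_exp.2 ?_)
          have h1 := inner_le_supportFun hT ((√2 / 2) • (x - y)) hz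
          have h2 := inner_le_supportFun hT x hz
          rw [real_inner_smul_left, inner_sub_left] at h1
          rw [real_inner_smul_left, real_inner_comm y z]
          have h3 : 0 ≤ 2 - √2 := by nlinarith [Real.sqrt_nonneg 2]
          have h4 := mul_le_mul_of_nonneg_left h1 (by positivity : 0 ≤ 2 * l)
          have h5 := mul_le_mul_of_nonneg_left h2 (mul_nonneg h3 hl)
          linarith
      _ = ENNReal.ofReal (Real.exp ((2 - √2) * l * supportFun T x)) *
          ENNReal.ofReal (Real.exp (‖(√2 * l) • z‖ ^ 2 / 2)) := by
          rw [lintegral_const_mul _ (by fun_prop), lintegral_exp_inner_stdGaussian]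
      _ ≤ _ := by
          rw [← ENNReal.ofReal_mul (by positivity), ← Real.exp_add]
          refine ENNReal.ofReal_le_ofReal (Real.exp_le_exp.2 ?_)
          rw [norm_smul, Real.norm_of_nonneg (by positivity), mul_pow, mul_pow, hs2]
          have : ‖z‖ ^ 2 ≤ R ^ 2 := by gcongr
          nlinarith [sq_nonneg l]
  -- The supremum need not be attained, so `z` is an `ε`-maximizer for `x` and `ε` tends to `0`
  -- afterwards.
  have hap : ∀ ε > 0, ∫⁻ y, ENNReal.ofReal (Real.exp (2 * l *
      (supportFun T x - supportFun T ((√2 / 2) • (x - y))))) ∂(stdGaussian E) ≤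
      ENNReal.ofReal (Real.exp (2 * l * ε) *
        Real.exp (l ^ 2 * R ^ 2 + (2 - √2) * l * supportFun T x)) := by
    intro ε hε
    obtain ⟨z, hz⟩ := exists_lt_of_lt_ciSup (sub_lt_self (supportFun T x) hε)
    rw [ENNReal.ofReal_mul (by positivity)]
    refine le_trans ?_ (mul_le_mul_right (key z z.2) _)
    rw [← lintegral_const_mul _ (by fun_prop)]
    refine lintegral_mono fun y => ?_
    rw [← ENNReal.ofReal_mul (by positivity), ← Real.exp_add]
    refine ENNReal.ofReal_le_ofReal (Real.exp_le_exp.2 ?_)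
    rw [← mul_add]
    exact mul_le_mul_of_nonneg_left (by linarith) (by positivity)
  have hlim : Filter.Tendsto (fun ε : ℝ => ENNReal.ofReal (Real.exp (2 * l * ε) *
      Real.exp (l ^ 2 * R ^ 2 + (2 - √2) * l * supportFun T x))) (nhdsWithin 0 (Set.Ioi 0))
      (nhds (ENNReal.ofReal (Real.exp (2 * l * 0) *
      Real.exp (l ^ 2 * R ^ 2 + (2 - √2) * l * supportFun T x)))) :=
    ((ENNReal.continuous_ofReal.comp (by fun_prop)).tendsto 0).mono_left nhdsWithin_le_nhds
  have := ge_of_tendsto hlim (Filter.eventually_of_mem self_mem_nhdsWithin hap)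
  simpa using this

/-- Exponential concentration of the supremum of a bounded Gaussian process. -/
theorem integral_exp_supportFun_le (hT : T ⊆ Metric.closedBall 0 R) (h0 : (0 : E) ∈ T)
    {l : ℝ} (hl : 0 ≤ l) :
    ∫ g, Real.exp (l * supportFun T g) ∂(stdGaussian E) ≤
      Real.exp ((1 + √2) * (l * ∫ g, supportFun T g ∂(stdGaussian E) + l ^ 2 * R ^ 2)) := by
  have hk := continuous_supportFun hT h0
  have hs2 : √2 ^ 2 = 2 := Real.sq_sqrt (by norm_num)
  have hs1 : 1 ≤ √2 := Real.one_le_sqrt.2 (by norm_num)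
  have hr : 0 ≤ 2 - √2 := by nlinarith [Real.sqrt_nonneg 2]
  set γ := stdGaussian E with hγ
  set F := supportFun T with hF
  set w := ∫ g, F g ∂γ with hw
  have iF : Integrable F γ := integrable_supportFun hT h0
  have iM : ∀ {c : ℝ}, 0 ≤ c → Integrable (fun g => Real.exp (c * F g)) γ := fun hc =>
    integrable_exp_supportFun hT h0 hc
  set M := ∫ g, Real.exp (l * F g) ∂γ with hM
  have hMpos : 0 < M := integral_exp_pos (iM hl)
  have iN : Integrable (fun g => Real.exp (-(l * F g))) γ := by
    refine (integrable_const (1 : ℝ)).mono (by fun_prop) (ae_of_all _ fun g => ?_)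
    rw [Real.norm_of_nonneg (by positivity)]
    have := mul_nonneg hl (supportFun_nonneg hT h0 g)
    simpa using this
  -- Jensen's inequality, through the tangent line of `exp` at the mean.
  have hN : Real.exp (-(l * w)) ≤ ∫ g, Real.exp (-(l * F g)) ∂γ := by
    have h1 : ∫ g, Real.exp (-(l * w)) * (1 - l * (F g - w)) ∂γ = Real.exp (-(l * w)) := by
      rw [integral_const_mul, integral_sub (by fun_prop) (by fun_prop), integral_const_mul,
        integral_sub iF (by fun_prop)]
      simp [hw]
    rw [← h1]
    refine integral_mono (by fun_prop) iN fun g => ?_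
    have h2 : Real.exp (-(l * F g)) = Real.exp (-(l * w)) * Real.exp (-(l * (F g - w))) := by
      rw [← Real.exp_add]; ring_nf
    simp only [h2]
    gcongr
    have := Real.add_one_le_exp (-(l * (F g - w)))
    linarith
  have hprod : ENNReal.ofReal (M * Real.exp (-(l * w))) ≤
      ∫⁻ p : E × E, ENNReal.ofReal (Real.exp (l * (F p.1 - F p.2))) ∂(γ.prod γ) := by
    have h1 : ∫⁻ p : E × E, ENNReal.ofReal (Real.exp (l * (F p.1 - F p.2))) ∂(γ.prod γ) =
        ENNReal.ofReal M * ENNReal.ofReal (∫ g, Real.exp (-(l * F g)) ∂γ) := by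
      rw [hM, ofReal_integral_eq_lintegral_ofReal (iM hl) (ae_of_all _ fun g => by positivity),
        ofReal_integral_eq_lintegral_ofReal iN (ae_of_all _ fun g => by positivity),
        ← lintegral_prod_mul (by fun_prop) (by fun_prop)]
      refine lintegral_congr fun p => ?_
      rw [← ENNReal.ofReal_mul (by positivity), ← Real.exp_add]
      ring_nf
    rw [h1, ← ENNReal.ofReal_mul hMpos.le]
    gcongr
  have hstep := lintegral_exp_supportFun_sub_le hT h0 hl
  rw [← hγ, ← hF] at hstep
  set B := ENNReal.ofReal (Real.exp (l ^ 2 * R ^ 2)) *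
        ∫⁻ g, ENNReal.ofReal (Real.exp ((2 - √2) * l * F g)) ∂γ with hB
  -- The rotation by `-π/4` carries `x` to `(x - y)/√2` and `(x - y)/√2` to `-y`, so the second
  -- increment has the law of the first.
  have hstep' : ∫⁻ p : E × E, ENNReal.ofReal (Real.exp (2 * l *
        (F ((√2 / 2) • (p.1 - p.2)) - F (-p.2)))) ∂(γ.prod γ) ≤ B := by
    refine le_trans (le_of_eq ?_) hstep
    rw [hγ, ← lintegral_prod_rotation_stdGaussian (-(Real.pi / 4))
      (f := fun p => ENNReal.ofReal (Real.exp (2 * l * (F p.1 - F ((√2 / 2) • (p.1 - p.2))))))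
      (by fun_prop)]
    refine lintegral_congr fun p => ?_
    simp only [Real.cos_neg, Real.sin_neg, Real.cos_pi_div_four, Real.sin_pi_div_four]
    congr 5
    · module
    · have : (√2 / 2) * (√2 / 2) = 1 / 2 := by nlinarith
      simp only [neg_neg, smul_sub, smul_add, neg_smul, smul_neg, smul_smul, this]
      module
  have hsymm : ∫⁻ p : E × E, ENNReal.ofReal (Real.exp (l * (F p.1 - F p.2))) ∂(γ.prod γ) =
      ∫⁻ p : E × E, ENNReal.ofReal (Real.exp (l * (F p.1 - F (-p.2)))) ∂(γ.prod γ) := by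
    have hneg : γ.map (fun x => -x) = γ :=
      stdGaussian_map (LinearIsometryEquiv.neg ℝ : E ≃ₗᵢ[ℝ] E)
    rw [lintegral_prod _ (by fun_prop), lintegral_prod _ (by fun_prop)]
    refine lintegral_congr fun x => ?_
    conv_lhs => rw [← hneg]
    rw [lintegral_map (by fun_prop) (by fun_prop)]
  have hle : ENNReal.ofReal (M * Real.exp (-(l * w))) ≤ B := by
    refine hprod.trans ?_
    rw [hsymm]
    -- The increment from `-y` to `x` is split at `(x - y)/√2`, and `e^(s+t) ≤ (e^(2s) + e^(2t)) /
    -- 2`.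
    calc _ ≤ ∫⁻ p : E × E, (2⁻¹ * ENNReal.ofReal (Real.exp (2 * l *
              (F p.1 - F ((√2 / 2) • (p.1 - p.2))))) +
            2⁻¹ * ENNReal.ofReal (Real.exp (2 * l *
              (F ((√2 / 2) • (p.1 - p.2)) - F (-p.2))))) ∂(γ.prod γ) := by
          refine lintegral_mono fun p => ?_
          have h3 : (2⁻¹ : ℝ≥0∞) = ENNReal.ofReal 2⁻¹ := by
            rw [ENNReal.ofReal_inv_of_pos (by norm_num)]; norm_num
          rw [h3, ← ENNReal.ofReal_mul (by norm_num), ← ENNReal.ofReal_mul (by norm_num),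
            ← ENNReal.ofReal_add (by positivity) (by positivity)]
          refine ENNReal.ofReal_le_ofReal ?_
          set s := l * (F p.1 - F ((√2 / 2) • (p.1 - p.2)))
          set t := l * (F ((√2 / 2) • (p.1 - p.2)) - F (-p.2))
          have e1 : l * (F p.1 - F (-p.2)) = s + t := by simp only [s, t]; ring
          have e2 : 2 * l * (F p.1 - F ((√2 / 2) • (p.1 - p.2))) = s + s := by
            simp only [s]; ring
          have e3 : 2 * l * (F ((√2 / 2) • (p.1 - p.2)) - F (-p.2)) = t + t := by
            simp only [t]; ring
          rw [e1, e2, e3, Real.exp_add, Real.exp_add, Real.exp_add]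
          nlinarith [sq_nonneg (Real.exp s - Real.exp t)]
      _ ≤ 2⁻¹ * B + 2⁻¹ * B := by
          rw [lintegral_add_left (by fun_prop), lintegral_const_mul _ (by fun_prop),
            lintegral_const_mul _ (by fun_prop)]
          gcongr
      _ = B := by rw [← add_mul, ENNReal.inv_two_add_inv_two, one_mul]
  -- The right side is `M ^ (2 - √2)`. As the exponent lies in `[0, 1]`, this is Jensen's inequality
  -- for a concave power, obtained from `e^(rt) ≤ r e^t + 1 - r`.
  have hint : ∫ g, Real.exp ((2 - √2) * l * F g) ∂γ ≤ Real.exp ((2 - √2) * Real.log M) := by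
    calc ∫ g, Real.exp ((2 - √2) * l * F g) ∂γ
        ≤ ∫ g, Real.exp ((2 - √2) * Real.log M) *
            ((2 - √2) * (M⁻¹ * Real.exp (l * F g)) + (√2 - 1)) ∂γ := by
          refine integral_mono (iM (mul_nonneg hr hl))
            (((((iM hl).const_mul _).const_mul _).add (integrable_const _)).const_mul _)
            fun g => ?_
          have h1 := convexOn_exp.2 (Set.mem_univ (l * F g - Real.log M)) (Set.mem_univ 0) hr
            (sub_nonneg.2 hs1) (by ring)
          simp only [smul_eq_mul, mul_zero, add_zero, Real.exp_zero, mul_one, Real.exp_sub,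
            Real.exp_log hMpos] at h1
          have h2 : Real.exp ((2 - √2) * l * F g) = Real.exp ((2 - √2) * Real.log M) *
              Real.exp ((2 - √2) * (l * F g - Real.log M)) := by
            rw [← Real.exp_add]; ring_nf
          simp only [h2]
          gcongr
          rw [div_eq_inv_mul] at h1
          exact h1
      _ = Real.exp ((2 - √2) * Real.log M) := by
          rw [integral_const_mul, integral_add (((iM hl).const_mul _).const_mul _)
            (integrable_const _), integral_const_mul, integral_const_mul, ← hM,
            inv_mul_cancel₀ hMpos.ne']
          simp only [integral_const, probReal_univ, one_smul]
          ring
  have hfin : M * Real.exp (-(l * w)) ≤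
      Real.exp (l ^ 2 * R ^ 2) * Real.exp ((2 - √2) * Real.log M) := by
    rw [hB, ← ofReal_integral_eq_lintegral_ofReal (iM (mul_nonneg hr hl))
      (ae_of_all _ fun g => by positivity), ← ENNReal.ofReal_mul (by positivity),
      ENNReal.ofReal_le_ofReal_iff (mul_nonneg (by positivity)
        (integral_nonneg fun g => by positivity))] at hle
    exact hle.trans (by gcongr)
  have hlog : Real.log M - l * w ≤ l ^ 2 * R ^ 2 + (2 - √2) * Real.log M := by
    rw [← Real.exp_le_exp, Real.exp_add, sub_eq_add_neg, Real.exp_add, Real.exp_log hMpos]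
    exact hfin
  rw [← Real.log_le_iff_le_exp hMpos]
  -- The inequality bounds `M` by a power of itself below one; solving for `log M` costs `1 / (√2 -
  -- 1) = 1 + √2`.
  have h6 : (1 + √2) * ((√2 - 1) * Real.log M) ≤ (1 + √2) * (l * w + l ^ 2 * R ^ 2) :=
    mul_le_mul_of_nonneg_left (by linarith) (by positivity)
  have h7 : (1 + √2) * ((√2 - 1) * Real.log M) = Real.log M := by
    have : (1 + √2) * (√2 - 1) = 1 := by nlinarith
    rw [← mul_assoc, this, one_mul]
  linarith

end Gaussian

/-! ### Independence of the pairs of measurement vector and sign. -/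

namespace OneBitCS.IsMeasurementModel

variable {Ω : Type*} [MeasurableSpace Ω] {m n : ℕ} {μ : Measure Ω} [IsProbabilityMeasure μ]
  {a : Fin m → Ω → EuclideanSpace ℝ (Fin n)} {x : EuclideanSpace ℝ (Fin n)} {θ : ℝ → ℝ}
  {y : Fin m → Ω → ℝ}

/-- The conditional probability of `y i ∈ B` given the measurement vectors is a measurable function
of `a i` alone. -/
theorem exists_condExp_indicator (h : IsMeasurementModel a x θ y μ) (ma : ∀ i, Measurable (a i))
    (mθ : Measurable θ) (i : Fin m) (B : Set ℝ) :
    ∃ φ : EuclideanSpace ℝ (Fin n) → ℝ, Measurable φ ∧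
      μ[(y i ⁻¹' B).indicator (fun _ => (1 : ℝ)) | sigmaOf a] =ᵐ[μ] fun ω => φ (a i ω) := by
  classical
  have hm : sigmaOf a ≤ (inferInstance : MeasurableSpace Ω) :=
    (measurable_pi_lambda _ ma).comap_le
  set p : ℝ := B.indicator (fun _ => (1 : ℝ)) 1
  set q : ℝ := B.indicator (fun _ => (1 : ℝ)) (-1)
  -- A function of a two-valued variable is affine in it, so the conditional mean determines the
  -- conditional law.
  have e : (y i ⁻¹' B).indicator (fun _ => (1 : ℝ)) =
      (fun _ => (p + q) / 2) + ((p - q) / 2) • y i := by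
    ext ω
    change B.indicator (fun _ => (1 : ℝ)) (y i ω) = _
    rcases h.one_bit i ω with h1 | h1
    · simp only [Pi.add_apply, Pi.smul_apply, h1, smul_eq_mul, q]; ring
    · simp only [Pi.add_apply, Pi.smul_apply, h1, smul_eq_mul, p]; ring
  have iy : Integrable (y i) μ := by
    refine (integrable_const (1 : ℝ)).mono (h.measurable i).aestronglyMeasurable
      (ae_of_all _ fun ω => ?_)
    rcases h.one_bit i ω with h1 | h1 <;> simp [h1]
  refine ⟨fun v => (p + q) / 2 + (p - q) / 2 * θ (inner ℝ v x), by fun_prop, ?_⟩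
  rw [e]
  filter_upwards [condExp_add (integrable_const ((p + q) / 2)) (iy.smul ((p - q) / 2)) (sigmaOf a),
    condExp_smul ((p - q) / 2) (y i) (sigmaOf a) (μ := μ), h.cond_mean i] with ω h1 h2 h3
  rw [h1, Pi.add_apply, h2, Pi.smul_apply, h3, condExp_const hm]
  rfl

/-- In the generalized linear model the pairs `(a i, y i)` are independent. -/
theorem iIndepFun_pair (h : IsMeasurementModel a x θ y μ) (ma : ∀ i, Measurable (a i))
    (ia : iIndepFun a μ) (mθ : Measurable θ) :
    iIndepFun (fun i ω => (a i ω, y i ω)) μ := by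
  classical
  have hm : sigmaOf a ≤ (inferInstance : MeasurableSpace Ω) :=
    (measurable_pi_lambda _ ma).comap_le
  have hma : ∀ i, Measurable[sigmaOf a] (a i) := fun i =>
    (measurable_pi_apply i).comp (comap_measurable fun ω i => a i ω)
  let R : Set (Set (EuclideanSpace ℝ (Fin n) × ℝ)) :=
    Set.image2 (· ×ˢ ·) {s | MeasurableSet s} {t | MeasurableSet t}
  refine iIndepSets.iIndep
    (fun i => ((ma i).prodMk (h.measurable i)).comap_le)
    (fun i => {s | ∃ t ∈ R, (fun ω => (a i ω, y i ω)) ⁻¹' t = s})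
    (fun i => isPiSystem_prod.comap _) (fun i => ?_) ?_
  · rw [← generateFrom_prod, MeasurableSpace.comap_generateFrom]; rfl
  rw [iIndepSets_iff]
  intro S f hf
  -- Rectangles form a generating π-system; indices outside `S` are padded with the whole space so
  -- that all products run over `Fin m`.
  have hf' : ∀ i, ∃ A : Set (EuclideanSpace ℝ (Fin n)), ∃ B : Set ℝ, MeasurableSet A ∧
      MeasurableSet B ∧ (if i ∈ S then f i else Set.univ) = a i ⁻¹' A ∩ y i ⁻¹' B := by
    intro i
    by_cases hi : i ∈ S
    · obtain ⟨_, ⟨A, hA, B, hB, rfl⟩, hfi⟩ := hf i hi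
      exact ⟨A, B, hA, hB, by rw [if_pos hi, ← hfi]; rfl⟩
    · exact ⟨Set.univ, Set.univ, .univ, .univ, by simp [hi]⟩
  choose A B hA hB hAB using hf'
  choose φ mφ hφ using fun i => exists_condExp_indicator h ma mθ i (B i)
  have hyB : ∀ i, MeasurableSet (y i ⁻¹' B i) := fun i => h.measurable i (hB i)
  have haA : ∀ i, MeasurableSet[sigmaOf a] (a i ⁻¹' A i) := fun i => hma i (hA i)
  have key : ∀ (s t : Set Ω) (g : Ω → ℝ), MeasurableSet[sigmaOf a] s → MeasurableSet t →
      μ[t.indicator (fun _ => (1 : ℝ)) | sigmaOf a] =ᵐ[μ] g →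
      μ.real (s ∩ t) = ∫ ω, s.indicator (fun _ => (1 : ℝ)) ω * g ω ∂μ := by
    intro s t g hs ht hg
    have hi : Integrable (t.indicator fun _ => (1 : ℝ)) μ := (integrable_const _).indicator ht
    have h1 := setIntegral_condExp hm hi hs
    rw [setIntegral_indicator ht, setIntegral_const, smul_eq_mul, mul_one] at h1
    rw [← h1, ← integral_indicator (hm _ hs)]
    refine integral_congr_ae ?_
    filter_upwards [hg] with ω hω
    by_cases hωs : ω ∈ s <;> simp [hωs, hω]
  have hsingle : ∀ i, μ.real (a i ⁻¹' A i ∩ y i ⁻¹' B i) =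
      ∫ ω, (A i).indicator (fun _ => (1 : ℝ)) (a i ω) * φ i (a i ω) ∂μ := fun i =>
    key _ _ _ (haA i) (hyB i) (hφ i)
  have hjoint : μ.real (⋂ i, a i ⁻¹' A i ∩ y i ⁻¹' B i) =
      ∫ ω, ∏ i, ((A i).indicator (fun _ => (1 : ℝ)) (a i ω) * φ i (a i ω)) ∂μ := by
    have hg : μ[(⋂ i, y i ⁻¹' B i).indicator (fun _ => (1 : ℝ)) | sigmaOf a] =ᵐ[μ]
        fun ω => ∏ i, φ i (a i ω) := by
      filter_upwards [h.cond_indep B hB, ae_all_iff.2 hφ] with ω h1 h2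
      rw [h1]
      exact Finset.prod_congr rfl fun i _ => h2 i
    rw [Set.iInter_inter_distrib, key _ _ _ (MeasurableSet.iInter haA)
      (MeasurableSet.iInter hyB) hg]
    refine integral_congr_ae (ae_of_all _ fun ω => ?_)
    simp only [Finset.prod_mul_distrib]
    congr 1
    by_cases hω : ∀ i, a i ω ∈ A i
    · rw [Set.indicator_of_mem (Set.mem_iInter.2 hω)]
      exact (Finset.prod_eq_one fun i _ => Set.indicator_of_mem (hω i) _).symm
    · rw [Set.indicator_of_notMem fun h' => hω (Set.mem_iInter.1 h')]
      push Not at hω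
      obtain ⟨i, hi⟩ := hω
      exact (Finset.prod_eq_zero (Finset.mem_univ i) (Set.indicator_of_notMem hi _)).symm
  -- After conditioning, each factor is a function of `a i` alone, so independence of the `a i`
  -- factorizes the integral.
  have hprod : μ.real (⋂ i, a i ⁻¹' A i ∩ y i ⁻¹' B i) =
      ∏ i, μ.real (a i ⁻¹' A i ∩ y i ⁻¹' B i) := by
    rw [hjoint, Finset.prod_congr rfl fun i _ => hsingle i]
    exact ia.integral_fun_prod_comp (f := fun i v => (A i).indicator (fun _ => (1 : ℝ)) v * φ i v)
      (fun i => (ma i).aemeasurable) fun i =>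
      ((measurable_const.indicator (hA i)).mul (mφ i)).aestronglyMeasurable
  have hset : ⋂ i ∈ S, f i = ⋂ i, a i ⁻¹' A i ∩ y i ⁻¹' B i := by
    simp_rw [← hAB]
    ext ω
    simp only [Set.mem_iInter]
    refine forall_congr' fun i => ?_
    by_cases hi : i ∈ S <;> simp [hi]
  have hprodS : ∏ i ∈ S, μ (f i) = ∏ i, μ (a i ⁻¹' A i ∩ y i ⁻¹' B i) := by
    rw [← Finset.prod_subset (Finset.subset_univ S)]
    · exact Finset.prod_congr rfl fun i hi => by rw [← hAB i, if_pos hi]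
    · intro i _ hi
      rw [← hAB i, if_neg hi, measure_univ]
  rw [hset, hprodS, ← ENNReal.toReal_eq_toReal_iff' (measure_ne_top _ _)
    (ENNReal.prod_ne_top fun i _ => measure_ne_top _ _), ENNReal.toReal_prod]
  exact hprod

end OneBitCS.IsMeasurementModel

/-! ### Gaussian domination of vectors and of the centered sum. -/

/-- A random vector with independent coordinates, each dominated by `c` times a standard Gaussian,
is dominated by `c` times a standard Gaussian vector. -/
theorem ConvexDom.stdGaussian_of_coord {Ω : Type*} [MeasurableSpace Ω] {μ : Measure Ω}
    [IsProbabilityMeasure μ] {n : ℕ} {V : Ω → EuclideanSpace ℝ (Fin n)} (mV : Measurable V)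
    (iV : iIndepFun (fun (j : Fin n) (ω : Ω) => V ω j) μ) {c : ℝ}
    (h : ∀ j, ConvexDom (μ.map fun ω => V ω j) ((gaussianReal 0 1).map fun x => c * x)) :
    ConvexDom (μ.map V)
      ((stdGaussian (EuclideanSpace ℝ (Fin n))).map fun g => c • g) := by
  let e : Fin n → EuclideanSpace ℝ (Fin n) := fun j => EuclideanSpace.single j 1
  let L : Fin n → ℝ →L[ℝ] EuclideanSpace ℝ (Fin n) := fun j =>
    ContinuousLinearMap.toSpanSingleton ℝ (e j)
  have mL : ∀ j, Measurable (L j) := fun j => (L j).continuous.measurable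
  have mc : ∀ j, Measurable fun ω => V ω j := fun j => by fun_prop
  have hdec : ∀ v : EuclideanSpace ℝ (Fin n), ∑ j, L j (v j) = v := by
    intro v
    ext k
    simp [L, e, Pi.single_apply]
  -- The vector is the sum of its components along the basis, which are independent random vectors.
  have hdom := ConvexDom.finset_sum (μ := μ) (μ' := Measure.pi fun _ : Fin n => gaussianReal 0 1)
    (V := fun j ω => L j (V ω j)) (W := fun j ω => L j (c * ω j))
    (fun j => (mL j).comp (mc j)) (fun j => (mL j).comp (by fun_prop))
    (iV.comp (fun j => L j) mL)
    (iIndepFun_pi (X := fun j x => L j (c * x)) fun j =>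
      ((mL j).comp (by fun_prop)).aemeasurable) (fun j => ?_) Finset.univ
  · have e1 : ∑ j, (fun ω => L j (V ω j)) = V := by
      ext1 ω
      rw [Finset.sum_apply, hdec]
    have e2 : (Measure.pi fun _ : Fin n => gaussianReal 0 1).map
        (∑ j, fun ω => L j (c * ω j)) =
        (stdGaussian (EuclideanSpace ℝ (Fin n))).map fun g => c • g := by
      rw [← map_pi_eq_stdGaussian, Measure.map_map (by fun_prop) (by fun_prop)]
      congr 1
      ext1 ω
      rw [Finset.sum_apply]
      exact hdec (c • WithLp.toLp 2 ω)
    rwa [e1, e2] at hdom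
  · have h1 := (h j).map (L j)
    rw [Measure.map_map (mL j) (mc j), Measure.map_map (mL j) (by fun_prop)] at h1
    have h2 : (Measure.pi fun _ : Fin n => gaussianReal 0 1).map (fun ω => L j (c * ω j)) =
        (gaussianReal 0 1).map (L j ∘ fun x => c * x) := by
      conv_rhs => rw [← (measurePreserving_eval (fun _ : Fin n => gaussianReal 0 1) j).map_eq]
      rw [Measure.map_map ((mL j).comp (by fun_prop)) (by fun_prop)]
      rfl
    rw [h2]
    exact h1

theorem identDistrib_neg_of_coord {Ω : Type*} [MeasurableSpace Ω] {μ : Measure Ω} {n : ℕ}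
    {V : Ω → EuclideanSpace ℝ (Fin n)}
    (iV : iIndepFun (fun (j : Fin n) (ω : Ω) => V ω j) μ)
    (h : ∀ j, IdentDistrib (fun ω => V ω j) (fun ω => -V ω j) μ μ) :
    IdentDistrib V (fun ω => -V ω) μ μ := by
  have h1 := IdentDistrib.pi h iV (iV.comp (fun _ x => -x) fun _ => measurable_neg)
  exact h1.comp (u := WithLp.toLp 2) (by fun_prop)

theorem map_sum_pi_stdGaussian (m n : ℕ) :
    (Measure.pi fun _ : Fin m => stdGaussian (EuclideanSpace ℝ (Fin n))).map
      (fun ω => ∑ i, ω i) =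
    (stdGaussian (EuclideanSpace ℝ (Fin n))).map fun g => √m • g := by
  have m1 : Measurable fun g : EuclideanSpace ℝ (Fin n) => √m • g := by fun_prop
  have m2 : Measurable fun ω : Fin m → EuclideanSpace ℝ (Fin n) => ∑ i, ω i := by fun_prop
  have := Measure.isProbabilityMeasure_map (μ := stdGaussian (EuclideanSpace ℝ (Fin n)))
    m1.aemeasurable
  have := Measure.isProbabilityMeasure_map
    (μ := Measure.pi fun _ : Fin m => stdGaussian (EuclideanSpace ℝ (Fin n))) m2.aemeasurable
  refine Measure.ext_of_charFun ?_
  rw [charFun_map_sum_pi_eq_prod]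
  ext t
  rw [charFun_map_smul, charFun_stdGaussian, Finset.prod_apply, Finset.prod_const,
    charFun_stdGaussian, ← Complex.exp_nat_mul, norm_smul, Real.norm_of_nonneg (by positivity),
    Finset.card_univ, Fintype.card_fin]
  congr 1
  rw [← Complex.ofReal_pow (√m * ‖t‖), mul_pow, Real.sq_sqrt (by positivity)]
  push_cast
  ring

theorem ciSup_abs_inner_eq_supportFun {E : Type*} [NormedAddCommGroup E] [InnerProductSpace ℝ E]
    {T : Set E} {R : ℝ} (hT : T ⊆ Metric.closedBall 0 R) (h0 : (0 : E) ∈ T)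
    (hneg : ∀ z ∈ T, -z ∈ T) (u : E) :
    ⨆ z : ↥T, |inner ℝ u (z : E)| = supportFun T u := by
  have : Nonempty ↥T := ⟨⟨0, h0⟩⟩
  have hle : ∀ z : ↥T, |inner ℝ u (z : E)| ≤ supportFun T u := fun z => by
    refine abs_le'.2 ⟨inner_le_supportFun hT u z.2, ?_⟩
    rw [← inner_neg_right]
    exact inner_le_supportFun hT u (hneg z z.2)
  refine le_antisymm (ciSup_le hle) (ciSup_le fun z => ?_)
  refine (le_abs_self _).trans
    (le_ciSup (f := fun z : ↥T => |inner ℝ u (z : E)|) ⟨supportFun T u, ?_⟩ z)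
  rintro _ ⟨z, rfl⟩
  exact hle z

/-- The centered sum `∑ (yᵢ aᵢ - E yᵢ aᵢ)`, which represents the centered objective. -/
noncomputable def centeredSum {Ω : Type*} [MeasurableSpace Ω] {m n : ℕ} (μ : Measure Ω)
    (a : Fin m → Ω → EuclideanSpace ℝ (Fin n)) (y : Fin m → Ω → ℝ) :
    Ω → EuclideanSpace ℝ (Fin n) :=
  ∑ i, fun ω => y i ω • a i ω - ∫ ω', y i ω' • a i ω' ∂μ

section

variable {Ω Ω' : Type*} [MeasurableSpace Ω] [MeasurableSpace Ω'] {μ : Measure Ω}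
  [IsProbabilityMeasure μ] {P : Measure Ω'} [IsProbabilityMeasure P] {m n : ℕ} {X : Ω' → ℝ}
  {a : Fin m → Ω → EuclideanSpace ℝ (Fin n)} {x : EuclideanSpace ℝ (Fin n)} {θ : ℝ → ℝ}
  {y : Fin m → Ω → ℝ}

omit [IsProbabilityMeasure μ] [IsProbabilityMeasure P] in
theorem integrable_measurement (hX : OneBitCS.IsSymmSubgaussianUnit X P)
    (ha : OneBitCS.IsMeasurementEnsemble a μ X P) (i : Fin m) : Integrable (a i) μ := by
  have h1 : Integrable X P := integrable_of_subgaussianNorm_lt_top hX.measurable hX.subgaussian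
  have h2 : ∀ j, Integrable (fun ω => a i ω j) μ := fun j => (ha.copies i j).integrable_iff.2 h1
  have h3 : Integrable (fun ω => ∑ j, a i ω j • EuclideanSpace.single j (1 : ℝ)) μ :=
    integrable_finsetSum _ fun j _ => (h2 j).smul_const _
  refine h3.congr (ae_of_all _ fun ω => ?_)
  ext k
  simp [Pi.single_apply]

omit [IsProbabilityMeasure μ] [IsProbabilityMeasure P] in
theorem integrable_signed_measurement (hX : OneBitCS.IsSymmSubgaussianUnit X P)
    (ha : OneBitCS.IsMeasurementEnsemble a μ X P) (hy : OneBitCS.IsMeasurementModel a x θ y μ)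
    (i : Fin m) : Integrable (fun ω => y i ω • a i ω) μ := by
  refine (integrable_measurement hX ha i).mono
    ((hy.measurable i).smul (ha.measurable i)).aestronglyMeasurable (ae_of_all _ fun ω => ?_)
  rcases hy.one_bit i ω with h | h <;> simp [h]

-- Linearity in `z` turns the centered process into one random vector, whose support function is
-- then the quantity to bound.
omit [IsProbabilityMeasure μ] [IsProbabilityMeasure P] in
theorem objective_sub_integral (hX : OneBitCS.IsSymmSubgaussianUnit X P)
    (ha : OneBitCS.IsMeasurementEnsemble a μ X P) (hy : OneBitCS.IsMeasurementModel a x θ y μ)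
    (z : EuclideanSpace ℝ (Fin n)) (ω : Ω) :
    OneBitCS.objective a y z ω - ∫ ω', OneBitCS.objective a y z ω' ∂μ =
      inner ℝ ((m : ℝ)⁻¹ • centeredSum μ a y ω) z := by
  have hi := integrable_signed_measurement hX ha hy
  have h1 : ∀ i, ∫ ω', y i ω' * inner ℝ (a i ω') z ∂μ =
      inner ℝ (∫ ω', y i ω' • a i ω' ∂μ) z := by
    intro i
    rw [real_inner_comm, ← integral_inner (hi i) z]
    simp only [real_inner_smul_right, real_inner_comm z]
  have h2 : ∀ i, Integrable (fun ω' => y i ω' * inner ℝ (a i ω') z) μ := by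
    intro i
    refine ((hi i).inner_const z (𝕜 := ℝ)).congr (ae_of_all _ fun ω => ?_)
    exact real_inner_smul_left _ _ _
  unfold OneBitCS.objective centeredSum
  rw [integral_const_mul, integral_finsetSum _ fun i _ => h2 i, ← mul_sub,
    ← Finset.sum_sub_distrib, real_inner_smul_left, one_div, Finset.sum_apply, sum_inner]
  congr 1
  refine Finset.sum_congr rfl fun i _ => ?_
  rw [h1, inner_sub_left, real_inner_smul_left]

/-- The centered sum is dominated by a Gaussian vector. -/
theorem ConvexDom.centeredSum (hX : OneBitCS.IsSymmSubgaussianUnit X P)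
    (ha : OneBitCS.IsMeasurementEnsemble a μ X P) (mθ : Measurable θ)
    (hy : OneBitCS.IsMeasurementModel a x θ y μ) :
    ConvexDom (μ.map (centeredSum μ a y))
      ((stdGaussian (EuclideanSpace ℝ (Fin n))).map fun g =>
        (40 * Real.exp 1 * (OneBitCS.subgaussianNorm X P).toReal * √m) • g) := by
  -- `c` serves each coordinate; symmetrization doubles it, and summing `m` independent Gaussian
  -- vectors contributes `√m`.
  set c := 20 * Real.exp 1 * (OneBitCS.subgaussianNorm X P).toReal with hc
  have hpair := hy.iIndepFun_pair ha.measurable ha.indep_vectors mθ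
  have hdom := ConvexDom.finset_sum (μ := μ)
    (μ' := Measure.pi fun _ : Fin m => stdGaussian (EuclideanSpace ℝ (Fin n)))
    (V := fun i ω => y i ω • a i ω - ∫ ω', y i ω' • a i ω' ∂μ)
    (W := fun i ω => (2 * c) • ω i)
    (fun i => ((hy.measurable i).smul (ha.measurable i)).sub_const _) (fun i => by fun_prop)
    (hpair.comp (fun i p => p.2 • p.1 - ∫ ω', y i ω' • a i ω' ∂μ) fun i => by fun_prop)
    (iIndepFun_pi (X := fun _ g => (2 * c) • g) fun i => by fun_prop) (fun i => ?_) Finset.univ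
  · have e : (Measure.pi fun _ : Fin m => stdGaussian (EuclideanSpace ℝ (Fin n))).map
        (∑ i, fun ω => (2 * c) • ω i) =
        (stdGaussian (EuclideanSpace ℝ (Fin n))).map fun g =>
          (40 * Real.exp 1 * (OneBitCS.subgaussianNorm X P).toReal * √m) • g := by
      have e1 : (∑ i, fun ω : Fin m → EuclideanSpace ℝ (Fin n) => (2 * c) • ω i) =
          (fun g => (2 * c) • g) ∘ fun ω => ∑ i, ω i := by
        ext1 ω
        simp [Finset.smul_sum]
      rw [e1, ← Measure.map_map (by fun_prop) (by fun_prop), map_sum_pi_stdGaussian,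
        Measure.map_map (by fun_prop) (by fun_prop)]
      congr 1
      ext1 g
      simp only [Function.comp_apply, smul_smul, hc]
      ring_nf
    rwa [e] at hdom
  · have hsym : IdentDistrib (a i) (fun ω => -a i ω) μ μ := by
      refine identDistrib_neg_of_coord (ha.indep_coords i) fun j => ?_
      exact ((ha.copies i j).trans hX.symmetric).trans
        ((ha.copies i j).symm.comp measurable_neg)
    have h1 := ConvexDom.centered_sign_smul (ha.measurable i) (hy.measurable i)
      (integrable_measurement hX ha i) (hy.one_bit i) hsym
    have h2 := ConvexDom.stdGaussian_of_coord (c := c) (ha.measurable i) (ha.indep_coords i)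
      fun j => by
        rw [(ha.copies i j).map_eq]
        exact ConvexDom.gaussianReal_of_subgaussian hX
    have h3 := h2.map ((2 : ℝ) • ContinuousLinearMap.id ℝ (EuclideanSpace ℝ (Fin n)))
    rw [Measure.map_map (ContinuousLinearMap.continuous _).measurable (ha.measurable i),
      Measure.map_map (ContinuousLinearMap.continuous _).measurable (by fun_prop)] at h3
    have h4 : (Measure.pi fun _ : Fin m => stdGaussian (EuclideanSpace ℝ (Fin n))).map
        (fun ω => (2 * c) • ω i) = (stdGaussian (EuclideanSpace ℝ (Fin n))).map
          (((2 : ℝ) • ContinuousLinearMap.id ℝ (EuclideanSpace ℝ (Fin n))) ∘ fun g => c • g) := by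
      conv_rhs => rw [← (measurePreserving_eval
        (fun _ : Fin m => stdGaussian (EuclideanSpace ℝ (Fin n))) i).map_eq]
      rw [Measure.map_map ((ContinuousLinearMap.continuous _).measurable.comp (by fun_prop))
        (by fun_prop)]
      congr 1
      ext1 ω
      simp [smul_smul]
    rw [h4]
    exact h1.trans h3

/-- Chernoff bound for the support function of a random vector dominated by a Gaussian vector. -/
theorem ConvexDom.measureReal_le_supportFun {U : Ω → EuclideanSpace ℝ (Fin n)} (mU : Measurable U)
    {D : ℝ} (hD : 0 < D) (hU : ConvexDom (μ.map U)
      ((stdGaussian (EuclideanSpace ℝ (Fin n))).map fun g => D • g))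
    {T : Set (EuclideanSpace ℝ (Fin n))} (hT : T ⊆ Metric.closedBall 0 2)
    (h0 : (0 : EuclideanSpace ℝ (Fin n)) ∈ T) {β : ℝ} (hβ : 0 < β) :
    μ.real {ω | D * (7 * (∫ g, supportFun T g ∂(stdGaussian (EuclideanSpace ℝ (Fin n))) + β)) ≤
      supportFun T (U ω)} ≤ Real.exp (-β ^ 2) := by
  set w := ∫ g, supportFun T g ∂(stdGaussian (EuclideanSpace ℝ (Fin n))) with hw
  have hw0 : 0 ≤ w := integral_nonneg fun g => supportFun_nonneg hT h0 g
  have hk := continuous_supportFun hT h0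
  -- Chernoff parameter `l = β / (2D)`. With `R = 2` and `√2 ≤ 3/2` the exponent is at most
  -- `(5/2)(βw/2 + β²) - (7/2)(βw + β²) ≤ -β²`, whence the factor 7.
  have hl : 0 < β / 2 / D := by positivity
  have hΦ := hU (fun u => Real.exp (β / 2 / D * supportFun T u)) ?_ (by fun_prop)
    fun u => by positivity
  · rw [lintegral_map (by fun_prop) mU, lintegral_map (by fun_prop) (by fun_prop)] at hΦ
    have e : ∀ g, β / 2 / D * supportFun T (D • g) = β / 2 * supportFun T g := fun g => by
      rw [supportFun_smul hD.le]; field_simp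
    simp_rw [e] at hΦ
    rw [← ofReal_integral_eq_lintegral_ofReal (integrable_exp_supportFun hT h0 (by positivity))
      (ae_of_all _ fun g => by positivity)] at hΦ
    have hM := mul_meas_ge_le_lintegral₀ (μ := μ)
      (f := fun ω => ENNReal.ofReal (Real.exp (β / 2 / D * supportFun T (U ω))))
      (by fun_prop) (ENNReal.ofReal (Real.exp (β / 2 * (7 * (w + β)))))
    set S := {ω | D * (7 * (w + β)) ≤ supportFun T (U ω)} with hS
    have hsub : S ⊆ {ω | ENNReal.ofReal (Real.exp (β / 2 * (7 * (w + β)))) ≤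
        ENNReal.ofReal (Real.exp (β / 2 / D * supportFun T (U ω)))} := by
      intro ω hω
      refine ENNReal.ofReal_le_ofReal (Real.exp_le_exp.2 ?_)
      have h1 := mul_le_mul_of_nonneg_left (show D * (7 * (w + β)) ≤ supportFun T (U ω) from hω)
        hl.le
      refine le_trans (le_of_eq ?_) h1
      field_simp
    have h2 : ENNReal.ofReal (Real.exp (β / 2 * (7 * (w + β)))) * μ S ≤
        ENNReal.ofReal (Real.exp ((1 + √2) * (β / 2 * w + (β / 2) ^ 2 * 2 ^ 2))) := by
      refine le_trans (by gcongr) (hM.trans (hΦ.trans (ENNReal.ofReal_le_ofReal ?_)))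
      exact integral_exp_supportFun_le hT h0 (by positivity)
    have h3 : Real.exp (β / 2 * (7 * (w + β))) * μ.real S ≤
        Real.exp ((1 + √2) * (β / 2 * w + (β / 2) ^ 2 * 2 ^ 2)) := by
      rw [← ofReal_measureReal, ← ENNReal.ofReal_mul (by positivity),
        ENNReal.ofReal_le_ofReal_iff (by positivity)] at h2
      exact h2
    rw [← le_div_iff₀' (by positivity), ← Real.exp_sub] at h3
    refine h3.trans (Real.exp_le_exp.2 ?_)
    have h4 : √2 ≤ 3 / 2 := by
      rw [Real.sqrt_le_left (by norm_num)]; norm_num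
    have h5 : 0 ≤ β / 2 * w + (β / 2) ^ 2 * 2 ^ 2 := by positivity
    have h6 := mul_le_mul_of_nonneg_right h4 h5
    have h7 : 0 ≤ β * w := by positivity
    nlinarith
  · have h1 : ConvexOn ℝ Set.univ fun u => β / 2 / D * supportFun T u :=
      (convexOn_supportFun hT h0).smul hl.le
    refine ⟨convex_univ, fun u hu v hv p q hp hq hpq => ?_⟩
    refine (Real.exp_le_exp.2 (h1.2 hu hv hp hq hpq)).trans ?_
    exact convexOn_exp.2 (Set.mem_univ _) (Set.mem_univ _) hp hq hpq

end

/-! ### The concentration inequality. -/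

theorem proposition2p1 :
    ∃ C : ℝ, 0 < C ∧
      ∀ (Ω Ω' : Type*) [MeasurableSpace Ω] [MeasurableSpace Ω']
        (μ : Measure Ω) [IsProbabilityMeasure μ] (P : Measure Ω') [IsProbabilityMeasure P]
        (m n : ℕ) (_ : 0 < m)
        (X : Ω' → ℝ) (_ : OneBitCS.IsSymmSubgaussianUnit X P)
        (a : Fin m → Ω → EuclideanSpace ℝ (Fin n))
        (_ : OneBitCS.IsMeasurementEnsemble a μ X P)
        (K : Set (EuclideanSpace ℝ (Fin n))) (_ : K ⊆ Metric.closedBall 0 1)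
        (x : EuclideanSpace ℝ (Fin n)) (_ : x ∈ K) (_ : ‖x‖ = 1)
        (θ : ℝ → ℝ) (_ : Measurable θ) (_ : ∀ t, θ t ∈ Set.Icc (-1 : ℝ) 1)
        (y : Fin m → Ω → ℝ) (_ : OneBitCS.IsMeasurementModel a x θ y μ)
        (β : ℝ) (_ : 0 < β),
        μ.real {ω | C * (OneBitCS.subgaussianNorm X P).toReal *
              ((OneBitCS.meanWidth K + β) / Real.sqrt m) ≤
            ⨆ z : ↥(K - K), |OneBitCS.objective a y z ω - ∫ ω', OneBitCS.objective a y z ω' ∂μ|}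
          ≤ 4 * Real.exp (-β ^ 2) := by
  -- `280 = 7 * 40`: the Chernoff factor times the domination constant.
  refine ⟨280 * Real.exp 1, by positivity, ?_⟩
  intro Ω Ω' _ _ μ _ P _ m n hm X hX a ha K hK x hx _ θ mθ _ y hy β hβ
  set κ := (OneBitCS.subgaussianNorm X P).toReal with hκ
  have hκ0 : 0 < κ := subgaussianNorm_toReal_pos hX
  have hm0 : (0 : ℝ) < m := by exact_mod_cast hm
  have hT : K - K ⊆ Metric.closedBall 0 2 := by
    rintro _ ⟨u, hu, v, hv, rfl⟩
    have h1 := mem_closedBall_zero_iff.1 (hK hu)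
    have h2 := mem_closedBall_zero_iff.1 (hK hv)
    rw [mem_closedBall_zero_iff]
    exact (norm_sub_le u v).trans (by linarith)
  have h0 : (0 : EuclideanSpace ℝ (Fin n)) ∈ K - K := ⟨x, hx, x, hx, sub_self x⟩
  have hneg : ∀ z ∈ K - K, -z ∈ K - K := by
    rintro _ ⟨u, hu, v, hv, rfl⟩
    exact ⟨v, hv, u, hu, (neg_sub u v).symm⟩
  have mU : Measurable (centeredSum μ a y) := by
    have : Measurable fun ω => ∑ i, (y i ω • a i ω - ∫ ω', y i ω' • a i ω' ∂μ) :=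
      Finset.measurable_sum _ fun i _ => ((hy.measurable i).smul (ha.measurable i)).sub_const _
    convert this
    simp [centeredSum]
  have hmain := ConvexDom.measureReal_le_supportFun mU (by positivity)
    (ConvexDom.centeredSum hX ha mθ hy) hT h0 hβ
  have hset : {ω | 280 * Real.exp 1 * κ * ((OneBitCS.meanWidth K + β) / √m) ≤
      ⨆ z : ↥(K - K), |OneBitCS.objective a y z ω - ∫ ω', OneBitCS.objective a y z ω' ∂μ|} =
      {ω | 40 * Real.exp 1 * κ * √m * (7 * (∫ g, supportFun (K - K) g
        ∂(stdGaussian (EuclideanSpace ℝ (Fin n))) + β)) ≤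
        supportFun (K - K) (centeredSum μ a y ω)} := by
    ext ω
    simp only [Set.mem_ofPred_eq, objective_sub_integral hX ha hy]
    -- Symmetry of `K - K` removes the absolute value; the factor `m⁻¹` then combines with `√m` in
    -- `D` to give `1/√m`.
    rw [ciSup_abs_inner_eq_supportFun hT h0 hneg, supportFun_smul (by positivity),
      le_inv_mul_iff₀ hm0]
    have e : (m : ℝ) * (280 * Real.exp 1 * κ * ((OneBitCS.meanWidth K + β) / √m)) =
        40 * Real.exp 1 * κ * √m * (7 * (OneBitCS.meanWidth K + β)) := by
      have h1 : (m : ℝ) = √m * √m := (Real.mul_self_sqrt hm0.le).symm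
      have h2 : 0 < √(m : ℝ) := Real.sqrt_pos.2 hm0
      generalize √(m : ℝ) = s at h1 h2 ⊢
      rw [h1]
      field_simp
      ring
    rw [e]
    rfl
  rw [hset]
  refine hmain.trans ?_
  -- The bound obtained is `exp (-β ^ 2)`; the factor 4 is slack.
  have := Real.exp_pos (-β ^ 2)
  linarith
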